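/- Let $M$ be a $W^*$-algebra and let $E$ be a $W^*$-correspondence over $M$, i.e. a self-dual right Hilbert $C^*$-module over $M$ with full $M$-valued inner product, together with a left action of $M$ given by a faithful normal $*$-homomorphism $\varphi : M \to \mathscr{L}(E)$ into the adjointable operators. Let $\sigma : M \to B(H)$ be a faithful normal unital representation on a Hilbert space $H$. For a representation $\pi$ of $M$ on $K$, $E\otimes_\pi K$ is the Hausdorff completion of the algebraic tensor product in the form $\langle \xi\otimes h,\eta\otimes k\rangle=\langle h,\pi(\langle\xi,\eta\rangle)k\rangle$, with the representation $\pi^E\circ\varphi : a\mapsto \varphi(a)\otimes I$ of $M$. For representations $\pi,\rho$ of $M$, $\mathfrak I(\pi,\rho)$ is the space of bounded operators $X$ with $X\pi(a)=\rho(a)X$ for all $a\in M$; in particular $\mathfrak I(\pi,\pi)=\pi(M)'$. Every $X\in\mathfrak I(\pi,\rho)$ induces the bounded operator $I_{E^{\otimes k}}\otimes X$ for each $k\ge 0$. Write $\varphi_k$ for the left action of $M$ on $E^{\otimes k}$ (with $E^{\otimes 0}=M$, $M\otimes_\sigma H=H$), and let $\mathscr F(E)\otimes_\sigma H=\bigoplus_{k\ge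 0}E^{\otimes k}\otimes_\sigma H$. An element $\eta$ of $E^\sigma=\mathfrak I(\sigma,\sigma^E\circ\varphi)$ has the powers $\eta^{(0)}=I$, $\eta^{(k+1)}=(I_{E^{\otimes k}}\otimes \eta)\eta^{(k)}$ and, if $\|\eta\|<1$, the Cauchy kernel $C(\eta)=[\,I_H\ \ \eta\ \ \eta^{(2)}\ \cdots]^T : H\to\mathscr F(E)\otimes_\sigma H$; the same notation is used with $\sigma^{(N)}=\mathrm{diag}(\sigma,\dots,\sigma)$ on $H^{(N)}=H\otimes\mathbb C^N$ in place of $\sigma$. The Schur class $\mathscr S(E,H,\sigma)$ is the set of all contractions $T=[T_{ij}]_{i,j\ge 0}$ on $\mathscr F(E)\otimes_\sigma H$ with $T_{ij}=0$ for $j<i$, $T_{0j}\,(\sigma^{E^{\otimes j}}\circ\varphi_j)(a)=\sigma(a)\,T_{0j}$ for all $a\in M$ and $j\ge0$, and $T_{ij}=I_E\otimes T_{i-1,j-1}$ for $1\le i\le j$. Let $N\ge 0$, let $\mathfrak z_1,\dots,\mathfrak z_N\in E^\sigma$ with $\|\mathfrak z_i\|<1$, and let $\Lambda_1,\dots,\Lambda_N\in\sigma(M)'$.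 Put $$U=\begin{bmatrix}I_H\\ \vdots\\ I_H\end{bmatrix},\quad V=\begin{bmatrix}\Lambda_1^*\\ \vdots\\ \Lambda_N^*\end{bmatrix},\quad \mathfrak z=\mathrm{diag}(\mathfrak z_1,\dots,\mathfrak z_N)\in \mathfrak I(\sigma^{(N)},(\sigma^{(N)})^E\circ\varphi),$$ and define $U_\infty,V_\infty: H^{(N)}\to\mathscr F(E)\otimes_\sigma H$ by $$U_\infty=\big[(I_{E^{\otimes k}}\otimes U^*)\,\mathfrak z^{(k)}\big]_{k\ge 0},\qquad V_\infty=\big[(I_{E^{\otimes k}}\otimes V^*)\,\mathfrak z^{(k)}\big]_{k\ge 0}.$$ Then the displacement equation $$A-\mathfrak z^*(I_E\otimes A)\mathfrak z=UU^*-VV^*$$ has exactly one solution $A\in\sigma^{(N)}(M)'$. This solution is the Pick matrix $$A=\Big[\,C(\mathfrak z_i)^*C(\mathfrak z_j)-\big((I_{\mathscr F(E)}\otimes\Lambda_i)C(\mathfrak z_i)\big)^*(I_{\mathscr F(E)}\otimes\Lambda_j)C(\mathfrak z_j)\Big]_{i,j=1}^N,$$ and $A$ is positive semidefinite if and only if there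 exists $T\in\mathscr S(E,H,\sigma)$ such that $TU_\infty=V_\infty$. -/

import Mathlib

set_option linter.unusedSectionVars false

universe u v

namespace WCorr

open scoped TensorProduct InnerProductSpace

/-- The `M`-valued inner product of a right Hilbert `M`-module. Mathlib's `CStarModule A E` is
linear over `A` from the left, so a right Hilbert module over `M` is a `CStarModule` over the
opposite algebra `Mᵐᵒᵖ`; here `⟨ξ, η a⟩ = ⟨ξ, η⟩ a` and `⟨ξ, η⟩* = ⟨η, ξ⟩`. -/
def ip (M : Type v) {E : Type u} [Inner Mᵐᵒᵖ E] (ξ η : E) : M :=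
  (inner Mᵐᵒᵖ ξ η).unop

section IP

variable {M : Type v} {E : Type u} [CStarAlgebra M] [PartialOrder M]
  [NormedAddCommGroup E] [NormedSpace ℂ E] [Module Mᵐᵒᵖ E] [CStarModule Mᵐᵒᵖ E]

lemma ip_add_right (ξ η ζ : E) : ip M ξ (η + ζ) = ip M ξ η + ip M ξ ζ := by
  simp [ip]

lemma ip_add_left (ξ η ζ : E) : ip M (ξ + η) ζ = ip M ξ ζ + ip M η ζ := by
  simp [ip]

lemma ip_sub_right (ξ η ζ : E) : ip M ξ (η - ζ) = ip M ξ η - ip M ξ ζ := by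
  simp [ip]

lemma ip_sub_left (ξ η ζ : E) : ip M (ξ - η) ζ = ip M ξ ζ - ip M η ζ := by
  simp [ip]

lemma ip_smul_right (c : ℂ) (ξ η : E) : ip M ξ (c • η) = c • ip M ξ η := by
  simp [ip]

lemma ip_smul_left (c : ℂ) (ξ η : E) : ip M (c • ξ) η = star c • ip M ξ η := by
  simp [ip]

lemma ip_sum_right {ι : Type*} (s : Finset ι) (ξ : E) (η : ι → E) :
    ip M ξ (∑ i ∈ s, η i) = ∑ i ∈ s, ip M ξ (η i) := by
  simp [ip]

lemma ip_sum_left {ι : Type*} (s : Finset ι) (ξ : ι → E) (η : E) :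
    ip M (∑ i ∈ s, ξ i) η = ∑ i ∈ s, ip M (ξ i) η := by
  simp [ip]

lemma ip_act_right (ξ η : E) (a : M) : ip M ξ (MulOpposite.op a • η) = ip M ξ η * a := by
  simp [ip]

lemma ip_act_left (ξ η : E) (a : M) : ip M (MulOpposite.op a • ξ) η = star a * ip M ξ η := by
  simp [ip]

lemma star_ip (ξ η : E) : star (ip M ξ η) = ip M η ξ := by
  simp only [ip, ← MulOpposite.unop_star, CStarModule.star_inner]

lemma ip_self_nonneg (ξ : E) : 0 ≤ ip M ξ ξ :=
  CStarModule.inner_self_nonneg (A := Mᵐᵒᵖ) (x := ξ)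

lemma eq_of_ip {ξ η : E} (h : ∀ ζ : E, ip M ζ ξ = ip M ζ η) : ξ = η := by
  have h1 : ip M (ξ - η) (ξ - η) = 0 := by rw [ip_sub_right, h, sub_self]
  have h2 : inner Mᵐᵒᵖ (ξ - η) (ξ - η) = 0 := MulOpposite.unop_injective h1
  exact sub_eq_zero.mp (CStarModule.inner_self.mp h2)

end IP

section Positivity

lemma exists_test {𝒜 : Type v} [CStarAlgebra 𝒜] [PartialOrder 𝒜] [StarOrderedRing 𝒜] (A : 𝒜)
    (hA : IsSelfAdjoint A) : ∃ N c : 𝒜, star N = N ∧ N * A * N = -(star c * c) ∧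
      (c = 0 → ∃ B : 𝒜, A = star B * B) := by
  have hN0 : 0 ≤ A⁻ := CFC.negPart_nonneg A
  have hNsa : IsSelfAdjoint A⁻ := hN0.isSelfAdjoint
  have hs : IsSelfAdjoint (CFC.sqrt A⁻) := (CFC.sqrt_nonneg A⁻).isSelfAdjoint
  have hcc : star (CFC.sqrt A⁻ * A⁻) * (CFC.sqrt A⁻ * A⁻) = A⁻ * A⁻ * A⁻ := by
    simp only [star_mul, hs.star_eq, hNsa.star_eq]
    rw [show A⁻ * CFC.sqrt A⁻ * (CFC.sqrt A⁻ * A⁻) = A⁻ * (CFC.sqrt A⁻ * CFC.sqrt A⁻) * A⁻ by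
      simp only [mul_assoc], CFC.sqrt_mul_sqrt_self A⁻ hN0]
  refine ⟨A⁻, CFC.sqrt A⁻ * A⁻, hNsa.star_eq, ?_, fun hc => ?_⟩
  · rw [hcc]
    have h1 : A⁻ * (A⁺ - A⁻) * A⁻ = -(A⁻ * A⁻ * A⁻) := by
      rw [mul_sub, sub_mul, mul_assoc A⁻ A⁺ A⁻, CFC.posPart_mul_negPart, mul_zero, zero_sub]
    rwa [CFC.posPart_sub_negPart A hA] at h1
  · have h3 : A⁻ * A⁻ * A⁻ = 0 := by rw [← hcc, hc, mul_zero]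
    have h4 : star (A⁻ * A⁻) * (A⁻ * A⁻) = 0 := by
      rw [star_mul, hNsa.star_eq, ← mul_assoc, h3, zero_mul]
    have h5 := CStarRing.star_mul_self_eq_zero_iff _ |>.mp h4
    have h6 : star A⁻ * A⁻ = 0 := by rw [hNsa.star_eq, h5]
    have hN : A⁻ = 0 := CStarRing.star_mul_self_eq_zero_iff _ |>.mp h6
    exact CStarAlgebra.nonneg_iff_eq_star_mul_self.mp ((CFC.negPart_eq_zero_iff A hA).mp hN)

/-- A hermitian matrix `G` over `M` with `∑ a_i* G_ij a_j ≥ 0` for all columns `a` is of the form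
`B* B`. -/
lemma exists_factor {M : Type v} [CStarAlgebra M] [PartialOrder M] [StarOrderedRing M]
    {n : ℕ} (G : Fin n → Fin n → M) (hG : ∀ i j, star (G i j) = G j i)
    (hpos : ∀ a : Fin n → M, 0 ≤ ∑ i, ∑ j, star (a i) * G i j * a j) :
    ∃ B : Fin n → Fin n → M, ∀ i j, G i j = ∑ k, star (B k i) * B k j := by
  let A : CStarMatrix (Fin n) (Fin n) M := CStarMatrix.ofMatrix G
  have hA : IsSelfAdjoint A := by
    ext i j
    exact hG j i
  obtain ⟨N, c, hNsa, hNAN, hfin⟩ := exists_test A hA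
  have hdiag : ∀ k, ∑ j, star (c j k) * c j k = 0 := by
    intro k
    have h1 : (star c * c) k k = ∑ j, star (c j k) * c j k := by
      rw [CStarMatrix.mul_apply]; rfl
    have h2 : (N * A * N) k k = ∑ i, ∑ j, star (N i k) * G i j * N j k := by
      rw [CStarMatrix.mul_apply, Finset.sum_comm]
      refine Finset.sum_congr rfl fun j _ => ?_
      rw [CStarMatrix.mul_apply, Finset.sum_mul]
      refine Finset.sum_congr rfl fun i _ => ?_
      have : N k i = star (N i k) := by
        conv_lhs => rw [← hNsa]
        rfl
      rw [this]; rfl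
    have h3 : 0 ≤ -∑ j, star (c j k) * c j k := by
      have h5 := hpos fun i => N i k
      rw [← h2, hNAN, CStarMatrix.neg_apply, h1] at h5
      exact h5
    have h4 : 0 ≤ ∑ j, star (c j k) * c j k :=
      Finset.sum_nonneg fun j _ => star_mul_self_nonneg _
    exact le_antisymm (by simpa using h3) h4
  have hc : c = 0 := by
    ext j k
    have := (Finset.sum_eq_zero_iff_of_nonneg fun j _ => star_mul_self_nonneg (c j k)).mp
      (hdiag k) j (Finset.mem_univ j)
    exact CStarRing.star_mul_self_eq_zero_iff _ |>.mp this
  obtain ⟨B, hB⟩ := hfin hc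
  refine ⟨fun i j => B i j, fun i j => ?_⟩
  have : A i j = (star B * B) i j := by rw [hB]
  rw [CStarMatrix.mul_apply] at this
  exact this

end Positivity

/-- A `C*`-correspondence over `M`: a right Hilbert `M`-module `E` with a left action of `M` given
by a `*`-homomorphism `φ` of `M` into the adjointable operators on `E`. -/
class Correspondence (M : Type v) (E : Type u) [CStarAlgebra M] [PartialOrder M]
    [NormedAddCommGroup E] [NormedSpace ℂ E] [Module Mᵐᵒᵖ E] [CStarModule Mᵐᵒᵖ E] where
  /-- the left action `φ` -/
  φ : M →ₙₐ[ℂ] (E →L[ℂ] E)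
  /-- `φ a` is adjointable with adjoint `φ (a*)` -/
  ip_φ_left : ∀ (a : M) (ξ η : E), ip M (φ a ξ) η = ip M ξ (φ (star a) η)

/-- A `C*`-correspondence `E` over a `W*`-algebra `M` is a (full, faithful) `W*`-correspondence if
the module is self-dual, its inner product is full, and the left action is faithful and normal.
Normality of a map (preservation of suprema of bounded increasing nets) is Mathlib's
`ScottContinuous`. -/
class IsWStarCorrespondence (M : Type v) (E : Type u) [CStarAlgebra M] [PartialOrder M]
    [StarOrderedRing M] [WStarAlgebra M]
    [NormedAddCommGroup E] [NormedSpace ℂ E] [CompleteSpace E] [Module Mᵐᵒᵖ E] [CStarModule Mᵐᵒᵖ E]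
    [Correspondence M E] : Prop where
  /-- every bounded `M`-linear map `E → M` is `⟨η, ·⟩` for some `η` -/
  selfDual : ∀ f : E →L[ℂ] M, (∀ (ξ : E) (a : M), f (MulOpposite.op a • ξ) = f ξ * a) →
    ∃ η : E, ∀ ξ : E, f ξ = ip M η ξ
  /-- the inner products generate `M` as an ultraweakly closed ideal; such an ideal is `M z` for a
  central projection `z`, so this says that no nonzero element annihilates all inner products -/
  full : ∀ c : M, (∀ ξ η : E, ip M ξ η * c = 0) → c = 0
  faithful : Function.Injective (Correspondence.φ : M →ₙₐ[ℂ] (E →L[ℂ] E))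
  /-- for adjointable operators on a self-dual module, suprema of bounded increasing nets are
  detected by the positive functionals `⟨ξ, · ξ⟩` -/
  normal : ∀ ξ : E, ScottContinuous fun a : M =>
    ip M ξ ((Correspondence.φ : M →ₙₐ[ℂ] (E →L[ℂ] E)) a ξ)

/-- A Hilbert space with a (possibly degenerate) `*`-representation of `M`. -/
structure HilbRep (M : Type v) [CStarAlgebra M] where
  /-- the Hilbert space -/
  carrier : Type u
  [instNACG : NormedAddCommGroup carrier]
  [instIPS : InnerProductSpace ℂ carrier]
  [instComplete : CompleteSpace carrier]
  /-- the representation -/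
  rep : M →⋆ₙₐ[ℂ] (carrier →L[ℂ] carrier)

attribute [instance] HilbRep.instNACG HilbRep.instIPS HilbRep.instComplete

instance (M : Type v) [CStarAlgebra M] : CoeSort (HilbRep.{u} M) (Type u) := ⟨HilbRep.carrier⟩

/-- The intertwining space `𝔍(π, ρ)` of bounded operators `T` with `T π(a) = ρ(a) T` for all `a`.
In particular `𝔍(π, π)` is the commutant `π(M)'`. -/
def Intertwiner {M : Type v} [CStarAlgebra M] (R S : HilbRep.{u} M) : Submodule ℂ (R →L[ℂ] S) where
  carrier := {T | ∀ a, T ∘L R.rep a = S.rep a ∘L T}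
  add_mem' hT hT' a := by
    rw [ContinuousLinearMap.add_comp, ContinuousLinearMap.comp_add, hT a, hT' a]
  zero_mem' a := by simp
  smul_mem' c T hT a := by
    rw [ContinuousLinearMap.smul_comp, ContinuousLinearMap.comp_smul, hT a]

section Rep

variable {M : Type v} [CStarAlgebra M] {R S Q : HilbRep.{u} M}

lemma apply_rep (T : Intertwiner R S) (a : M) (x : R) :
    T.1 (R.rep a x) = S.rep a (T.1 x) :=
  congrArg (fun f : R →L[ℂ] S => f x) (T.2 a)

/-- Composition of intertwiners. -/
def Intertwiner.comp (T : Intertwiner S Q) (T' : Intertwiner R S) : Intertwiner R Q :=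
  ⟨T.1 ∘L T'.1, fun a => by
    ext x
    simp [apply_rep T, apply_rep T']⟩

/-- The adjoint of an intertwiner. -/
noncomputable def Intertwiner.adj (T : Intertwiner R S) : Intertwiner S R :=
  ⟨T.1.adjoint, fun a => by
    have h := congrArg ContinuousLinearMap.adjoint (T.2 (star a))
    rw [ContinuousLinearMap.adjoint_comp, ContinuousLinearMap.adjoint_comp,
      ← ContinuousLinearMap.star_eq_adjoint, ← ContinuousLinearMap.star_eq_adjoint, ← map_star,
      ← map_star, star_star] at h
    exact h.symm⟩

/-- The identity intertwiner. -/
def Intertwiner.id (R : HilbRep.{u} M) : Intertwiner R R :=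
  ⟨ContinuousLinearMap.id ℂ R, fun _ => rfl⟩

lemma rep_star_inner (R : HilbRep.{u} M) (a : M) (x y : R) :
    inner ℂ (R.rep a x) y = inner ℂ x (R.rep (star a) y) := by
  rw [map_star, ContinuousLinearMap.star_eq_adjoint, ContinuousLinearMap.adjoint_inner_right]

end Rep

section Form

variable {M : Type v} (E : Type u) [CStarAlgebra M] [PartialOrder M]
  [NormedAddCommGroup E] [NormedSpace ℂ E] [Module Mᵐᵒᵖ E] [CStarModule Mᵐᵒᵖ E]
  (R : HilbRep.{u} M)

/-- The functional `η ⊗ y ↦ ⟨x, π(⟨ξ, η⟩) y⟩` on the algebraic tensor product. -/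
noncomputable def formAux (ξ : E) (x : R) : E ⊗[ℂ] R →ₗ[ℂ] ℂ :=
  TensorProduct.lift (LinearMap.mk₂ ℂ (fun η y => inner ℂ x (R.rep (ip M ξ η) y))
    (fun η η' y => by simp [ip_add_right])
    (fun c η y => by simp [ip_smul_right])
    (fun η y y' => by simp)
    (fun c η y => by simp))

@[simp]
lemma formAux_tmul (ξ η : E) (x y : R) :
    formAux E R ξ x (η ⊗ₜ y) = inner ℂ x (R.rep (ip M ξ η) y) := rfl

/-- The sesquilinear form `⟨ξ ⊗ x, η ⊗ y⟩ = ⟨x, π(⟨ξ, η⟩) y⟩` on the algebraic tensor product. -/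
noncomputable def form : E ⊗[ℂ] R →ₗ⋆[ℂ] E ⊗[ℂ] R →ₗ[ℂ] ℂ :=
  TensorProduct.lift (LinearMap.mk₂'ₛₗ (starRingEnd ℂ) (starRingEnd ℂ) (formAux E R)
    (fun ξ ξ' x => by
      apply TensorProduct.ext'; intro η y; simp [formAux, ip_add_left])
    (fun c ξ x => by
      apply TensorProduct.ext'; intro η y; simp [formAux, ip_smul_left])
    (fun ξ x x' => by
      apply TensorProduct.ext'; intro η y; simp [formAux])
    (fun c ξ x => by
      apply TensorProduct.ext'; intro η y; simp [formAux, mul_comm]))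

@[simp]
lemma form_tmul (ξ η : E) (x y : R) :
    form E R (ξ ⊗ₜ x) (η ⊗ₜ y) = inner ℂ x (R.rep (ip M ξ η) y) := rfl

lemma form_conj (z w : E ⊗[ℂ] R) : starRingEnd ℂ (form E R w z) = form E R z w := by
  induction z using TensorProduct.induction_on with
  | zero => simp
  | add z z' hz hz' => simp [hz, hz']
  | tmul ξ x =>
    induction w using TensorProduct.induction_on with
    | zero => simp
    | add z z' hz hz' => simp [hz, hz']
    | tmul η y =>
      rw [form_tmul, form_tmul, inner_conj_symm, rep_star_inner, star_ip]

lemma gram_sum {n : ℕ} (x : Fin n → R) (G B : Fin n → Fin n → M)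
    (hB : ∀ i j, G i j = ∑ k, star (B k i) * B k j) :
    ∑ i, ∑ j, inner ℂ (x i) (R.rep (G i j) (x j))
      = ((∑ k, ‖∑ i, R.rep (B k i) (x i)‖ ^ 2 : ℝ) : ℂ) := by
  have h1 : ∀ k, ((‖∑ i, R.rep (B k i) (x i)‖ ^ 2 : ℝ) : ℂ)
      = ∑ i, ∑ j, inner ℂ (x i) (R.rep (star (B k i) * B k j) (x j)) := by
    intro k
    rw [Complex.ofReal_pow, ← RCLike.ofReal_eq_complex_ofReal, ← inner_self_eq_norm_sq_to_K,
      sum_inner]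
    refine Finset.sum_congr rfl fun i _ => ?_
    rw [inner_sum]
    refine Finset.sum_congr rfl fun j _ => ?_
    rw [rep_star_inner, map_mul]; rfl
  rw [Complex.ofReal_sum, Finset.sum_congr rfl fun k _ => h1 k]
  conv_rhs => rw [Finset.sum_comm]
  refine Finset.sum_congr rfl fun i _ => ?_
  conv_rhs => rw [Finset.sum_comm]
  refine Finset.sum_congr rfl fun j _ => ?_
  rw [hB, map_sum, _root_.sum_apply, inner_sum]

lemma form_sum {n : ℕ} (ξ : Fin n → E) (x : Fin n → R) (B : Fin n → Fin n → M)
    (hB : ∀ i j, ip M (ξ i) (ξ j) = ∑ k, star (B k i) * B k j) :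
    form E R (∑ i, ξ i ⊗ₜ x i) (∑ i, ξ i ⊗ₜ x i)
      = ((∑ k, ‖∑ i, R.rep (B k i) (x i)‖ ^ 2 : ℝ) : ℂ) := by
  rw [← gram_sum R x _ B hB, Finset.sum_comm]
  simp only [map_sum, LinearMap.sum_apply, form_tmul]

lemma sum_act {n : ℕ} (ξ η : Fin n → E) (a : Fin n → M) :
    ∑ i, ∑ j, star (a i) * ip M (ξ i) (η j) * a j
      = ip M (∑ i, MulOpposite.op (a i) • ξ i) (∑ j, MulOpposite.op (a j) • η j) := by
  rw [Finset.sum_comm]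
  simp only [ip_sum_left, ip_sum_right, ip_act_left, ip_act_right, Finset.sum_mul]

end Form

section Tensor

variable {M : Type v} (E : Type u) [CStarAlgebra M] [PartialOrder M] [StarOrderedRing M]
  [NormedAddCommGroup E] [NormedSpace ℂ E] [Module Mᵐᵒᵖ E] [CStarModule Mᵐᵒᵖ E]
  (R S Q : HilbRep.{u} M)

lemma exists_gram_factor {n : ℕ} (ξ : Fin n → E) :
    ∃ B : Fin n → Fin n → M, ∀ i j, ip M (ξ i) (ξ j) = ∑ k, star (B k i) * B k j :=
  exists_factor _ (fun i j => star_ip _ _) fun a => by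
    rw [sum_act]; exact ip_self_nonneg _

lemma form_self_nonneg (z : E ⊗[ℂ] R) : 0 ≤ (form E R z z).re := by
  obtain ⟨n, ξ, x, rfl⟩ := TensorProduct.exists_sum_tmul_eq z
  obtain ⟨B, hB⟩ := exists_gram_factor E ξ (M := M)
  rw [form_sum E R ξ x B hB, Complex.ofReal_re]
  positivity

variable {R S} in
lemma form_ampl_le (T : Intertwiner R S) (z : E ⊗[ℂ] R) :
    (form E S (TensorProduct.map LinearMap.id T.1.toLinearMap z)
      (TensorProduct.map LinearMap.id T.1.toLinearMap z)).re ≤ ‖T‖ ^ 2 * (form E R z z).re := by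
  obtain ⟨n, ξ, x, rfl⟩ := TensorProduct.exists_sum_tmul_eq z
  obtain ⟨B, hB⟩ := exists_gram_factor E ξ (M := M)
  have h1 : TensorProduct.map LinearMap.id T.1.toLinearMap (∑ j, ξ j ⊗ₜ[ℂ] x j)
      = ∑ j, ξ j ⊗ₜ[ℂ] T.1 (x j) := by simp
  rw [h1, form_sum E S ξ (fun j => T.1 (x j)) B hB, form_sum E R ξ x B hB, Complex.ofReal_re,
    Complex.ofReal_re, Finset.mul_sum]
  refine Finset.sum_le_sum fun k _ => ?_
  have h2 : ∑ i, S.rep (B k i) (T.1 (x i)) = T.1 (∑ i, R.rep (B k i) (x i)) := by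
    rw [map_sum]
    exact Finset.sum_congr rfl fun i _ => (apply_rep T _ _).symm
  rw [h2, ← mul_pow]
  gcongr
  exact T.1.le_opNorm _

lemma φ_act [Correspondence M E] (a b : M) (ξ : E) :
    Correspondence.φ a (MulOpposite.op b • ξ) = MulOpposite.op b • Correspondence.φ a ξ := by
  refine eq_of_ip (M := M) fun ζ => ?_
  have h : ∀ η : E, ip M ζ (Correspondence.φ a η) = ip M (Correspondence.φ (star a) ζ) η := by
    intro η
    rw [Correspondence.ip_φ_left, star_star]
  rw [h, ip_act_right, ip_act_right, h]

lemma ip_φ_φ [Correspondence M E] (a : M) (ξ η : E) :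
    ip M (Correspondence.φ a ξ) (Correspondence.φ a η)
      = ip M ξ (Correspondence.φ (star a * a) η) := by
  rw [Correspondence.ip_φ_left, map_mul]; rfl

lemma ip_φ_le [Correspondence M E] (a : M) (ξ : E) :
    ip M (Correspondence.φ a ξ) (Correspondence.φ a ξ) ≤ ((‖a‖ ^ 2 : ℝ) : ℂ) • ip M ξ ξ := by
  have h1 : star a * a ≤ algebraMap ℝ M (‖a‖ ^ 2) := CStarAlgebra.star_mul_le_algebraMap_norm_sq
  obtain ⟨c, hc⟩ := CStarAlgebra.nonneg_iff_eq_star_mul_self.mp (sub_nonneg.mpr h1)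
  have h2 : algebraMap ℝ M (‖a‖ ^ 2) = ((‖a‖ ^ 2 : ℝ) : ℂ) • (1 : M) := by
    rw [Algebra.algebraMap_eq_smul_one, Complex.coe_smul]
  have h3 : 0 ≤ ip M (ξ - Correspondence.φ (1 : M) ξ) (ξ - Correspondence.φ (1 : M) ξ) :=
    ip_self_nonneg _
  have h4 : ip M (ξ - Correspondence.φ (1 : M) ξ) (ξ - Correspondence.φ (1 : M) ξ)
      = ip M ξ ξ - ip M ξ (Correspondence.φ (1 : M) ξ) := by
    rw [ip_sub_left, ip_sub_right, ip_sub_right, ip_φ_φ, Correspondence.ip_φ_left]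
    simp
  have h5 : 0 ≤ ip M (Correspondence.φ c ξ) (Correspondence.φ c ξ) := ip_self_nonneg _
  rw [ip_φ_φ, ← hc, h2, map_sub, map_smul, _root_.sub_apply,
    _root_.smul_apply, ip_sub_right, ip_smul_right, ← ip_φ_φ] at h5
  rw [h4] at h3
  have h6 : (0 : M) ≤ ((‖a‖ ^ 2 : ℝ) : ℂ) • (ip M ξ ξ - ip M ξ (Correspondence.φ (1 : M) ξ)) := by
    rw [Complex.coe_smul]
    exact smul_nonneg (by positivity) h3
  rw [smul_sub] at h6
  have h7 := add_nonneg h5 h6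
  rw [← sub_nonneg]
  convert h7 using 1
  abel

lemma form_act_le [Correspondence M E] (a : M) (z : E ⊗[ℂ] R) :
    (form E R (TensorProduct.map (Correspondence.φ a).toLinearMap LinearMap.id z)
      (TensorProduct.map (Correspondence.φ a).toLinearMap LinearMap.id z)).re
      ≤ ‖a‖ ^ 2 * (form E R z z).re := by
  obtain ⟨n, ξ, x, rfl⟩ := TensorProduct.exists_sum_tmul_eq z
  obtain ⟨B, hB⟩ := exists_gram_factor E ξ (M := M)
  obtain ⟨B', hB'⟩ := exists_gram_factor E (fun i => Correspondence.φ a (ξ i)) (M := M)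
  obtain ⟨D, hD⟩ := exists_factor
    (fun i j => ((‖a‖ ^ 2 : ℝ) : ℂ) • ip M (ξ i) (ξ j)
      - ip M (Correspondence.φ a (ξ i)) (Correspondence.φ a (ξ j)))
    (fun i j => by simp [star_ip]) (fun b => by
      have h := ip_φ_le E a (∑ i, MulOpposite.op (b i) • ξ i)
      simp only [map_sum, φ_act] at h
      rw [← sum_act, ← sum_act, ← sub_nonneg] at h
      convert h using 1
      simp only [mul_sub, sub_mul, Finset.sum_sub_distrib, Finset.smul_sum, mul_smul_comm,
        smul_mul_assoc])
  have h1 : TensorProduct.map (Correspondence.φ a).toLinearMap LinearMap.id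
      (∑ j, ξ j ⊗ₜ[ℂ] x j) = ∑ j, (Correspondence.φ a (ξ j)) ⊗ₜ[ℂ] x j := by simp
  rw [h1]
  have h2 : ((‖a‖ ^ 2 : ℝ) : ℂ) * form E R (∑ j, ξ j ⊗ₜ[ℂ] x j) (∑ j, ξ j ⊗ₜ[ℂ] x j)
      - form E R (∑ j, (Correspondence.φ a (ξ j)) ⊗ₜ[ℂ] x j)
        (∑ j, (Correspondence.φ a (ξ j)) ⊗ₜ[ℂ] x j)
      = ((∑ k, ‖∑ i, R.rep (D k i) (x i)‖ ^ 2 : ℝ) : ℂ) := by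
    rw [← gram_sum R x _ D hD]
    simp only [map_sum, LinearMap.sum_apply, form_tmul, map_sub, map_smul,
      _root_.sub_apply, inner_sub_right, _root_.smul_apply,
      inner_smul_right, Finset.sum_sub_distrib, Finset.mul_sum]
    congr 1 <;> rw [Finset.sum_comm]
  have h3 := congrArg Complex.re h2
  rw [Complex.sub_re, Complex.re_ofReal_mul, Complex.ofReal_re] at h3
  have h4 : 0 ≤ ∑ k, ‖∑ i, R.rep (D k i) (x i)‖ ^ 2 := by positivity
  linarith

/-- The algebraic tensor product of `E` and `R`, a type synonym carrying the semi-inner product. -/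
def PreTens : Type u := E ⊗[ℂ] R

noncomputable instance : AddCommGroup (PreTens E R) := inferInstanceAs (AddCommGroup (E ⊗[ℂ] R))
noncomputable instance : Module ℂ (PreTens E R) := inferInstanceAs (Module ℂ (E ⊗[ℂ] R))

/-- The algebraic tensor product with and without its semi-inner product. -/
noncomputable def ofPre : PreTens E R ≃ₗ[ℂ] E ⊗[ℂ] R := LinearEquiv.refl ℂ _

/-- The positive semidefinite form `⟨ξ ⊗ x, η ⊗ y⟩ = ⟨x, π(⟨ξ, η⟩) y⟩`. -/
noncomputable abbrev preTensCore : PreInnerProductSpace.Core ℂ (PreTens E R) where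
  inner z w := form E R (ofPre E R z) (ofPre E R w)
  conj_inner_symm z w := form_conj E R _ _
  re_inner_nonneg z := form_self_nonneg E R _
  add_left x y z := by simp
  smul_left x y c := by simp

noncomputable instance : SeminormedAddCommGroup (PreTens E R) :=
  InnerProductSpace.Core.toSeminormedAddCommGroup (c := preTensCore E R)
noncomputable instance : InnerProductSpace ℂ (PreTens E R) :=
  InnerProductSpace.ofCore (preTensCore E R)

lemma preTens_inner_def (z w : PreTens E R) :
    inner ℂ z w = form E R (ofPre E R z) (ofPre E R w) := rfl

lemma preTens_norm_sq (z : PreTens E R) :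
    ‖z‖ ^ 2 = (form E R (ofPre E R z) (ofPre E R z)).re := by
  rw [← preTens_inner_def, ← RCLike.re_eq_complex_re, inner_self_eq_norm_sq]

variable {R S} in
/-- `I_E ⊗ T` on the algebraic tensor product. -/
noncomputable def preAmpl (T : Intertwiner R S) : PreTens E R →L[ℂ] PreTens E S :=
  LinearMap.mkContinuous ((ofPre E S).symm.toLinearMap ∘ₗ
    TensorProduct.map LinearMap.id T.1.toLinearMap ∘ₗ (ofPre E R).toLinearMap) ‖T‖ (by
    intro z
    rw [← sq_le_sq₀ (norm_nonneg _) (by positivity), mul_pow, preTens_norm_sq, preTens_norm_sq]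
    exact form_ampl_le E T _)

/-- `φ(a) ⊗ I` on the algebraic tensor product. -/
noncomputable def preAct [Correspondence M E] (a : M) : PreTens E R →L[ℂ] PreTens E R :=
  LinearMap.mkContinuous ((ofPre E R).symm.toLinearMap ∘ₗ
    TensorProduct.map (Correspondence.φ a).toLinearMap LinearMap.id ∘ₗ
      (ofPre E R).toLinearMap) ‖a‖ (by
    intro z
    rw [← sq_le_sq₀ (norm_nonneg _) (by positivity), mul_pow, preTens_norm_sq, preTens_norm_sq]
    exact form_act_le E R a _)

variable {E R} in
/-- The elementary tensor `ξ ⊗ x` in the algebraic tensor product. -/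
noncomputable def preTmul (ξ : E) (x : R) : PreTens E R := (ofPre E R).symm (ξ ⊗ₜ x)

lemma preTmul_inner (ξ η : E) (x y : R) :
    inner ℂ (preTmul ξ x) (preTmul η y) = inner ℂ x (R.rep (ip M ξ η) y) := rfl

variable {R S} in
lemma preAmpl_tmul (T : Intertwiner R S) (ξ : E) (x : R) :
    preAmpl E T (preTmul ξ x) = preTmul ξ (T.1 x) := rfl

lemma preAct_tmul [Correspondence M E] (a : M) (ξ : E) (x : R) :
    preAct E R a (preTmul ξ x) = preTmul (Correspondence.φ a ξ) x := rfl

variable {E R} in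
lemma preTens_induction {p : PreTens E R → Prop} (h0 : p 0) (ht : ∀ ξ x, p (preTmul ξ x))
    (ha : ∀ z w, p z → p w → p (z + w)) (z : PreTens E R) : p z :=
  TensorProduct.induction_on (motive := fun z => p z) z h0 ht ha

end Tensor

section Hilbert

variable {M : Type v} (E : Type u) [CStarAlgebra M] [PartialOrder M] [StarOrderedRing M]
  [NormedAddCommGroup E] [NormedSpace ℂ E] [Module Mᵐᵒᵖ E] [CStarModule Mᵐᵒᵖ E]
  [Correspondence M E]

/-- The Hausdorff completion of the algebraic tensor product in its semi-inner product. -/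
abbrev TensSpace (R : HilbRep.{u} M) : Type u := UniformSpace.Completion (PreTens E R)

variable {E} {R S Q : HilbRep.{u} M}

/-- The elementary tensor `ξ ⊗ x` in the completion. -/
noncomputable def ctmul (ξ : E) (x : R) : TensSpace E R :=
  ((preTmul ξ x : PreTens E R) : UniformSpace.Completion (PreTens E R))

lemma tensSpace_ext {F : Type*} [NormedAddCommGroup F] [NormedSpace ℂ F]
    {f g : TensSpace E R →L[ℂ] F}
    (h : ∀ (ξ : E) (x : R), f (ctmul ξ x) = g (ctmul ξ x)) : f = g := by
  refine ContinuousLinearMap.ext fun z => ?_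
  refine UniformSpace.Completion.induction_on (p := fun z : TensSpace E R => f z = g z) z
    (isClosed_eq f.continuous g.continuous) fun z => ?_
  induction z using preTens_induction with
  | h0 => rw [UniformSpace.Completion.coe_zero, map_zero, map_zero]
  | ht ξ x => exact h ξ x
  | ha z w hz hw => rw [UniformSpace.Completion.coe_add, map_add, map_add, hz, hw]

lemma ctmul_inner (ξ η : E) (x y : R) :
    inner ℂ (ctmul ξ x) (ctmul η y) = inner ℂ x (R.rep (ip M ξ η) y) := by
  rw [← preTmul_inner]
  exact UniformSpace.Completion.inner_coe _ _

lemma ctmul_add_left (ξ η : E) (x : R) : ctmul (ξ + η) x = ctmul ξ x + ctmul η x := by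
  rw [ctmul, ctmul, ctmul, ← UniformSpace.Completion.coe_add]
  congr 1
  simp [preTmul, TensorProduct.add_tmul]

lemma ctmul_smul_left (c : ℂ) (ξ : E) (x : R) : ctmul (c • ξ) x = c • ctmul ξ x := by
  rw [ctmul, ctmul, ← UniformSpace.Completion.coe_smul]
  congr 1

lemma ctmul_zero_left (x : R) : ctmul (0 : E) x = 0 := by
  simpa using ctmul_smul_left (0 : ℂ) (0 : E) x

variable (E R) in
/-- `φ(a) ⊗ I` on the completion. -/
noncomputable def act (a : M) : TensSpace E R →L[ℂ] TensSpace E R := (preAct E R a).completion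

lemma act_ctmul (a : M) (ξ : E) (x : R) :
    act E R a (ctmul ξ x) = ctmul (Correspondence.φ a ξ) x :=
  ContinuousLinearMap.completion_apply_coe _ _

lemma act_star (a : M) : act E R (star a) = star (act E R a) := by
  rw [ContinuousLinearMap.star_eq_adjoint]
  refine tensSpace_ext fun ξ x => ?_
  refine ext_inner_left ℂ fun w => ?_
  rw [ContinuousLinearMap.adjoint_inner_right, ← inner_conj_symm, ← inner_conj_symm (act E R a w)]
  congr 1
  revert w
  suffices h : innerSL ℂ (act E R (star a) (ctmul ξ x))
      = innerSL ℂ (ctmul ξ x) ∘L act E R a from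
    fun w => congrArg (fun f : TensSpace E R →L[ℂ] ℂ => f w) h
  refine tensSpace_ext fun η y => ?_
  rw [ContinuousLinearMap.comp_apply, innerSL_apply_apply, innerSL_apply_apply, act_ctmul,
    act_ctmul, ctmul_inner, ctmul_inner, Correspondence.ip_φ_left, star_star]

variable (E) in
/-- The Hilbert space `E ⊗_π R`, the Hausdorff completion of the algebraic tensor product in the
form `⟨ξ ⊗ x, η ⊗ y⟩ = ⟨x, π(⟨ξ, η⟩) y⟩`, with the induced representation
`π^E ∘ φ : a ↦ φ(a) ⊗ I`. -/
noncomputable def tens (R : HilbRep.{u} M) : HilbRep.{u} M where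
  carrier := TensSpace E R
  rep :=
    { toFun := act E R
      map_smul' := fun c a => tensSpace_ext fun ξ x => by
        simp [act_ctmul, ctmul_smul_left]
      map_zero' := tensSpace_ext fun ξ x => by
        simp [act_ctmul, ctmul_zero_left]
      map_add' := fun a b => tensSpace_ext fun ξ x => by
        simp [act_ctmul, ctmul_add_left]
      map_mul' := fun a b => tensSpace_ext fun ξ x => by
        simp [act_ctmul]
      map_star' := act_star }

/-- The elementary tensor `ξ ⊗ x` in `E ⊗_π R`. -/
noncomputable def tmul (ξ : E) (x : R) : tens E R := ctmul ξ x

lemma tmul_inner (ξ η : E) (x y : R) :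
    inner ℂ (tmul ξ x) (tmul η y) = inner ℂ x (R.rep (ip M ξ η) y) :=
  ctmul_inner ξ η x y

lemma tens_rep_tmul (a : M) (ξ : E) (x : R) :
    (tens E R).rep a (tmul ξ x) = tmul (Correspondence.φ a ξ) x :=
  act_ctmul a ξ x

/-- Two bounded operators on `E ⊗_π R` agree if they agree on elementary tensors. -/
lemma tens_ext {F : Type*} [NormedAddCommGroup F] [NormedSpace ℂ F] {f g : tens E R →L[ℂ] F}
    (h : ∀ (ξ : E) (x : R), f (tmul ξ x) = g (tmul ξ x)) : f = g :=
  tensSpace_ext h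

/-- `I_E ⊗ T` on the completion. -/
noncomputable def amplAux (T : Intertwiner R S) : TensSpace E R →L[ℂ] TensSpace E S :=
  (preAmpl E T).completion

lemma amplAux_ctmul (T : Intertwiner R S) (ξ : E) (x : R) :
    amplAux T (ctmul ξ x) = ctmul ξ (T.1 x) :=
  ContinuousLinearMap.completion_apply_coe _ _

lemma norm_amplAux_le (T : Intertwiner R S) : ‖amplAux (E := E) T‖ ≤ ‖T‖ := by
  refine ContinuousLinearMap.opNorm_le_bound _ (norm_nonneg _) fun z => ?_
  induction z using UniformSpace.Completion.induction_on with
  | hp => exact isClosed_le (by fun_prop) (by fun_prop)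
  | ih z =>
    rw [amplAux, ContinuousLinearMap.completion_apply_coe, UniformSpace.Completion.norm_coe,
      UniformSpace.Completion.norm_coe]
    exact ContinuousLinearMap.le_of_opNorm_le _
      (LinearMap.mkContinuous_norm_le _ (norm_nonneg T) _) z

/-- `I_E ⊗ T` for a bounded operator `T` that intertwines the representations: the bounded operator
with `(I_E ⊗ T)(ξ ⊗ x) = ξ ⊗ T x`. -/
noncomputable def ampl (T : Intertwiner R S) : Intertwiner (tens E R) (tens E S) :=
  ⟨amplAux T, fun a => by
    refine tensSpace_ext (E := E) (R := R) fun ξ x => ?_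
    change amplAux T (act E R a (ctmul ξ x)) = act E S a (amplAux T (ctmul ξ x))
    rw [act_ctmul, amplAux_ctmul, amplAux_ctmul, act_ctmul]⟩

lemma ampl_tmul (T : Intertwiner R S) (ξ : E) (x : R) :
    (ampl (E := E) T).1 (tmul ξ x) = tmul ξ (T.1 x) :=
  amplAux_ctmul T ξ x

lemma norm_ampl_le (T : Intertwiner R S) : ‖ampl (E := E) T‖ ≤ ‖T‖ :=
  norm_amplAux_le T

lemma inner_ampl (T : Intertwiner R S) (T' : Intertwiner Q S) (z : tens E R) (w : tens E Q) :
    inner ℂ ((ampl (E := E) T).1 z) ((ampl (E := E) T').1 w)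
      = inner ℂ z ((ampl (E := E) (Intertwiner.comp (Intertwiner.adj T) T')).1 w) := by
  revert w
  suffices h : innerSL ℂ ((ampl (E := E) T).1 z) ∘L (ampl (E := E) T').1
      = innerSL ℂ z ∘L (ampl (E := E) (Intertwiner.comp (Intertwiner.adj T) T')).1 from
    fun w => congrArg (fun f : tens E Q →L[ℂ] ℂ => f w) h
  refine tens_ext fun η y => ?_
  simp only [ContinuousLinearMap.comp_apply, innerSL_apply_apply, ampl_tmul]
  rw [← inner_conj_symm, ← inner_conj_symm z]
  congr 1
  revert z
  suffices h : innerSL ℂ (tmul η (T'.1 y)) ∘L (ampl (E := E) T).1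
      = innerSL ℂ (tmul η ((Intertwiner.comp (Intertwiner.adj T) T').1 y)) from
    fun w => congrArg (fun f : tens E R →L[ℂ] ℂ => f w) h
  refine tens_ext fun ξ x => ?_
  simp only [ContinuousLinearMap.comp_apply, innerSL_apply_apply, ampl_tmul, tmul_inner]
  rw [← apply_rep T]
  exact (ContinuousLinearMap.adjoint_inner_left _ _ _).symm

end Hilbert

section Fock

variable {M : Type v} (E : Type u) [CStarAlgebra M] [PartialOrder M] [StarOrderedRing M]
  [NormedAddCommGroup E] [NormedSpace ℂ E] [Module Mᵐᵒᵖ E] [CStarModule Mᵐᵒᵖ E]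
  [Correspondence M E]

/-- The space `E^{⊗ k} ⊗_π R`, realised as `E ⊗ (E ⊗ (⋯ ⊗ (E ⊗_π R)))`, with its representation
`a ↦ φ_k(a) ⊗ I`, which is `π^{E^{⊗ k}} ∘ φ_k`. For `k = 0` it is `M ⊗_π R = R`. -/
@[reducible]
noncomputable def tensPow (k : ℕ) (R : HilbRep.{u} M) : HilbRep.{u} M :=
  k.rec R fun _ S => tens E S

variable {E} {R S : HilbRep.{u} M}

/-- The elementary tensor `ξ_1 ⊗ ⋯ ⊗ ξ_k ⊗ x`. -/
noncomputable def elem : (k : ℕ) → (Fin k → E) → R → tensPow E k R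
  | 0, _, x => x
  | k + 1, ξ, x => tmul (R := tensPow E k R) (ξ 0) (elem k (fun i => ξ i.succ) x)

/-- The `M`-valued inner product of `ξ_1 ⊗ ⋯ ⊗ ξ_k` and `η_1 ⊗ ⋯ ⊗ η_k` in `E^{⊗ k}`, multiplied
from the left by `a` in the second entry: `⟨ξ_1 ⊗ ⋯, φ_k(a) (η_1 ⊗ ⋯)⟩`. -/
noncomputable def ipPow : (k : ℕ) → M → (Fin k → E) → (Fin k → E) → M
  | 0, a, _, _ => a
  | k + 1, a, ξ, η =>
    ipPow k (ip M (ξ 0) (Correspondence.φ a (η 0))) (fun i => ξ i.succ) (fun i => η i.succ)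

lemma elem_inner (k : ℕ) : ∀ (a : M) (ξ η : Fin k → E) (x y : R),
    inner ℂ (elem k ξ x) ((tensPow E k R).rep a (elem k η y))
      = inner ℂ x (R.rep (ipPow k a ξ η) y) := by
  induction k with
  | zero => intro a ξ η x y; rfl
  | succ k ih =>
    intro a ξ η x y
    change inner ℂ (tmul (R := tensPow E k R) _ _)
      ((tens E (tensPow E k R)).rep a (tmul (R := tensPow E k R) _ _)) = _
    rw [tens_rep_tmul, tmul_inner, ih]; rfl

/-- The bounded operator `x ↦ ξ ⊗ x`. -/
noncomputable def tmulCLM (ξ : E) : R →L[ℂ] tens E R :=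
  LinearMap.mkContinuous
    { toFun := fun x => tmul ξ x
      map_add' := fun x y => by
        change ctmul ξ (x + y) = ctmul ξ x + ctmul ξ y
        rw [ctmul, ctmul, ctmul, ← UniformSpace.Completion.coe_add]
        congr 1
        simp [preTmul, TensorProduct.tmul_add]
      map_smul' := fun c x => by
        change ctmul ξ (c • x) = c • ctmul ξ x
        rw [ctmul, ctmul, ← UniformSpace.Completion.coe_smul]
        congr 1
        simp [preTmul] }
    (√‖R.rep (ip M ξ ξ)‖) fun x => by
      rw [← sq_le_sq₀ (norm_nonneg _) (by positivity), mul_pow, Real.sq_sqrt (norm_nonneg _)]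
      change ‖tmul ξ x‖ ^ 2 ≤ _
      rw [← inner_self_eq_norm_sq (𝕜 := ℂ), tmul_inner]
      calc RCLike.re (inner ℂ x (R.rep (ip M ξ ξ) x)) ≤ ‖x‖ * ‖R.rep (ip M ξ ξ) x‖ :=
            re_inner_le_norm _ _
        _ ≤ ‖x‖ * (‖R.rep (ip M ξ ξ)‖ * ‖x‖) := by
            gcongr
            exact ContinuousLinearMap.le_opNorm _ _
        _ = ‖R.rep (ip M ξ ξ)‖ * ‖x‖ ^ 2 := by ring

/-- Bounded operators on `E^{⊗ k} ⊗_π R` are determined by their values on elementary tensors. -/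
lemma tensPow_ext (k : ℕ) {F : Type*} [NormedAddCommGroup F] [NormedSpace ℂ F] :
    ∀ {f g : tensPow E k R →L[ℂ] F},
    (∀ (ξ : Fin k → E) (x : R), f (elem k ξ x) = g (elem k ξ x)) → f = g := by
  induction k with
  | zero => exact fun h => ContinuousLinearMap.ext fun x => h (fun i => i.elim0) x
  | succ k ih =>
    intro f g h
    refine tens_ext (R := tensPow E k R) fun ξ z => ?_
    let f' : tens E (tensPow E k R) →L[ℂ] F := f
    let g' : tens E (tensPow E k R) →L[ℂ] F := g
    have h1 : f' ∘L tmulCLM ξ = g' ∘L tmulCLM ξ := ih fun ξ' x => h (Fin.cons ξ ξ') x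
    exact congrArg (fun f : tensPow E k R →L[ℂ] F => f z) h1

/-- `I_{E^{⊗ k}} ⊗ T` as an operator from `E^{⊗ k} ⊗ R` to `E^{⊗ k} ⊗ S`. -/
noncomputable def amplPow (T : Intertwiner R S) :
    (k : ℕ) → Intertwiner (tensPow E k R) (tensPow E k S)
  | 0 => T
  | k + 1 => ampl (R := tensPow E k R) (S := tensPow E k S) (amplPow T k)

lemma norm_amplPow_le (T : Intertwiner R S) (k : ℕ) : ‖amplPow (E := E) T k‖ ≤ ‖T‖ := by
  induction k with
  | zero => exact le_rfl
  | succ k ih => exact (norm_ampl_le (amplPow (E := E) T k)).trans ih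

/-- `I_{E^{⊗ k}} ⊗ η` as an operator from `E^{⊗ k} ⊗ R` to `E^{⊗ (k + 1)} ⊗ R`, for an
intertwiner `η` from `R` to `E ⊗ R`. -/
noncomputable def shiftPow (η : Intertwiner R (tens E R)) :
    (k : ℕ) → Intertwiner (tensPow E k R) (tensPow E (k + 1) R)
  | 0 => η
  | k + 1 => ampl (R := tensPow E k R) (S := tensPow E (k + 1) R) (shiftPow η k)

/-- `η^{(k)} = (I_{E^{⊗ (k-1)}} ⊗ η) ⋯ (I_E ⊗ η) η`, an operator from `R` to `E^{⊗ k} ⊗ R`. -/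
noncomputable def genPow (η : Intertwiner R (tens E R)) :
    (k : ℕ) → Intertwiner R (tensPow E k R)
  | 0 => Intertwiner.id R
  | k + 1 => Intertwiner.comp (shiftPow η k) (genPow η k)

lemma norm_shiftPow_le (η : Intertwiner R (tens E R)) (k : ℕ) : ‖shiftPow η k‖ ≤ ‖η‖ := by
  induction k with
  | zero => exact le_rfl
  | succ k ih => exact (norm_ampl_le (shiftPow η k)).trans ih

lemma norm_genPow_apply_le (η : Intertwiner R (tens E R)) (k : ℕ) (x : R) :
    ‖(genPow η k).1 x‖ ≤ ‖η‖ ^ k * ‖x‖ := by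
  induction k with
  | zero => simp [genPow, Intertwiner.id]
  | succ k ih =>
    calc ‖(shiftPow η k).1 ((genPow η k).1 x)‖ ≤ ‖η‖ * ‖(genPow η k).1 x‖ :=
          (shiftPow η k).1.le_of_opNorm_le (norm_shiftPow_le η k) _
      _ ≤ ‖η‖ * (‖η‖ ^ k * ‖x‖) := by gcongr
      _ = ‖η‖ ^ (k + 1) * ‖x‖ := by ring

variable (E R) in
/-- The Hilbert space `𝓕(E) ⊗_π R`, the Hilbert direct sum of the spaces `E^{⊗ k} ⊗_π R`. -/
abbrev Fock : Type u := lp (fun k : ℕ => (tensPow E k R : Type u)) 2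

/-- The entry `T_ij : E^{⊗ j} ⊗ R → E^{⊗ i} ⊗ R` of an operator on `𝓕(E) ⊗ R`. -/
noncomputable def entry (T : Fock E R →L[ℂ] Fock E R) (i j : ℕ) :
    tensPow E j R →L[ℂ] tensPow E i R :=
  lp.evalCLM ℂ (fun k : ℕ => (tensPow E k R : Type u)) 2 i ∘L T ∘L
    lp.singleContinuousLinearMap ℂ (fun k : ℕ => (tensPow E k R : Type u)) 2 j

variable (E R) in
/-- The Schur class: contractions `T = [T_ij]` on `𝓕(E) ⊗_σ H` that are upper triangular, whose
first row intertwines, `T_0j (σ^{E^{⊗ j}} ∘ φ_j)(a) = σ(a) T_0j`, and that are of Toeplitz type,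
`T_{i+1,j+1} = I_E ⊗ T_ij` for `i ≤ j`. (The operator `I_E ⊗ T_ij` makes sense because `T_ij`
intertwines; this is part of the third condition, and follows inductively from the second one.) -/
structure IsSchur (T : Fock E R →L[ℂ] Fock E R) : Prop where
  contractive : ‖T‖ ≤ 1
  upper : ∀ i j, j < i → entry T i j = 0
  intertwines : ∀ j, entry T 0 j ∈ Intertwiner (tensPow E j R) R
  toeplitz : ∀ i j, i ≤ j → ∃ h : entry T i j ∈ Intertwiner (tensPow E j R) (tensPow E i R),
    entry T (i + 1) (j + 1) = (ampl (E := E) ⟨entry T i j, h⟩).1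

/-- The Schur class as a set of operators. -/
def schurClass : Set (Fock E R →L[ℂ] Fock E R) := {T | IsSchur E R T}

/-- The Cauchy kernel `C(η) = [I, η, η^{(2)}, …]^T : R → 𝓕(E) ⊗ R` for `‖η‖ < 1`. -/
noncomputable def cauchy (η : Intertwiner R (tens E R)) (hη : ‖η‖ < 1) : R →L[ℂ] Fock E R :=
  have hsum : ∀ (x : R) (s : Finset ℕ), ∑ k ∈ s, ‖(genPow η k).1 x‖ ^ (2 : ENNReal).toReal
      ≤ (√((1 - ‖η‖ ^ 2)⁻¹) * ‖x‖) ^ (2 : ENNReal).toReal := by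
    intro x s
    have h1 : ‖η‖ ^ 2 < 1 := pow_lt_one₀ (norm_nonneg _) hη two_ne_zero
    have h2 := hasSum_geometric_of_lt_one (sq_nonneg ‖η‖) h1
    have h0 : 0 ≤ (1 - ‖η‖ ^ 2)⁻¹ := inv_nonneg.mpr (sub_nonneg.mpr h1.le)
    simp only [ENNReal.toReal_ofNat, Real.rpow_ofNat]
    rw [mul_pow, Real.sq_sqrt h0]
    calc ∑ k ∈ s, ‖(genPow η k).1 x‖ ^ 2 ≤ ∑ k ∈ s, (‖η‖ ^ 2) ^ k * ‖x‖ ^ 2 := by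
          refine Finset.sum_le_sum fun k _ => ?_
          calc ‖(genPow η k).1 x‖ ^ 2 ≤ (‖η‖ ^ k * ‖x‖) ^ 2 := by
                gcongr; exact norm_genPow_apply_le η k x
            _ = (‖η‖ ^ 2) ^ k * ‖x‖ ^ 2 := by ring
      _ = (∑ k ∈ s, (‖η‖ ^ 2) ^ k) * ‖x‖ ^ 2 := by rw [Finset.sum_mul]
      _ ≤ (1 - ‖η‖ ^ 2)⁻¹ * ‖x‖ ^ 2 := by
          gcongr
          exact sum_le_hasSum s (fun k _ => by positivity) h2
  LinearMap.mkContinuous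
    { toFun := fun x => ⟨fun k => (genPow η k).1 x, memℓp_gen' (hsum x)⟩
      map_add' := fun x y => by ext k; simp only [map_add]; rfl
      map_smul' := fun c x => by ext k; simp }
    (√((1 - ‖η‖ ^ 2)⁻¹)) fun x =>
      lp.norm_le_of_forall_sum_le (by norm_num) (by positivity) (hsum x)

lemma cauchy_apply (η : Intertwiner R (tens E R)) (hη : ‖η‖ < 1) (x : R) (k : ℕ) :
    (cauchy η hη x : Fock E R) k = (genPow η k).1 x := rfl

/-- The diagonal operator `I_{𝓕(E)} ⊗ T` from `𝓕(E) ⊗ R` to `𝓕(E) ⊗ S`. -/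
noncomputable def fockAmpl (T : Intertwiner R S) : Fock E R →L[ℂ] Fock E S :=
  have hsum : ∀ (f : Fock E R) (s : Finset ℕ),
      ∑ k ∈ s, ‖(amplPow (E := E) T k).1 (f k)‖ ^ (2 : ENNReal).toReal
      ≤ (‖T‖ * ‖f‖) ^ (2 : ENNReal).toReal := by
    intro f s
    have h1 := lp.sum_rpow_le_norm_rpow (p := 2) (by norm_num) f s
    simp only [ENNReal.toReal_ofNat, Real.rpow_ofNat] at h1 ⊢
    calc ∑ k ∈ s, ‖(amplPow (E := E) T k).1 (f k)‖ ^ 2 ≤ ∑ k ∈ s, ‖T‖ ^ 2 * ‖f k‖ ^ 2 := by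
          refine Finset.sum_le_sum fun k _ => ?_
          rw [← mul_pow]
          gcongr
          exact (amplPow (E := E) T k).1.le_of_opNorm_le (norm_amplPow_le T k) _
      _ = ‖T‖ ^ 2 * ∑ k ∈ s, ‖f k‖ ^ 2 := by rw [Finset.mul_sum]
      _ ≤ ‖T‖ ^ 2 * ‖f‖ ^ 2 := by gcongr
      _ = (‖T‖ * ‖f‖) ^ 2 := by ring
  LinearMap.mkContinuous
    { toFun := fun f => ⟨fun k => (amplPow (E := E) T k).1 (f k), memℓp_gen' (hsum f)⟩
      map_add' := fun x y => by ext k; simp only [lp.coeFn_add, Pi.add_apply, map_add]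
      map_smul' := fun c x => by ext k; simp }
    ‖T‖ fun f => lp.norm_le_of_forall_sum_le (by norm_num) (by positivity) (hsum f)

lemma fockAmpl_apply (T : Intertwiner R S) (f : Fock E R) (k : ℕ) :
    (fockAmpl (E := E) T f : Fock E S) k = (amplPow (E := E) T k).1 (f k) := rfl

end Fock

section Copies

variable {M : Type v} [CStarAlgebra M] (N : ℕ) (R : HilbRep.{u} M)

/-- The Hilbert space `R ⊗ ℂ^N`, that is `N` copies of `R` with the `ℓ²` norm. -/
abbrev CopySpace : Type u := PiLp 2 fun _ : Fin N => (R : Type u)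

/-- The diagonal operator `diag(T, …, T)`. -/
noncomputable def diagCLM (T : R →L[ℂ] R) : CopySpace N R →L[ℂ] CopySpace N R :=
  (PiLp.continuousLinearEquiv 2 ℂ fun _ : Fin N => (R : Type u)).symm.toContinuousLinearMap ∘L
    ContinuousLinearMap.pi fun j => T ∘L PiLp.proj 2 (fun _ : Fin N => (R : Type u)) j

lemma diagCLM_apply (T : R →L[ℂ] R) (h : CopySpace N R) (j : Fin N) :
    diagCLM N R T h j = T (h j) := rfl

/-- The representation `π^{(N)} = diag(π, …, π)` on `R^{(N)} = R ⊗ ℂ^N`. -/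
noncomputable def copies : HilbRep.{u} M where
  carrier := CopySpace N R
  rep :=
    { toFun := fun a => diagCLM N R (R.rep a)
      map_smul' := fun c a => by
        ext h j
        simp [diagCLM_apply]
      map_zero' := by
        ext h j
        simp [diagCLM_apply]
      map_add' := fun a b => by
        ext h j
        simp [diagCLM_apply]
      map_mul' := fun a b => by
        ext h j
        simp [diagCLM_apply]
      map_star' := fun a => by
        rw [ContinuousLinearMap.star_eq_adjoint]
        refine (ContinuousLinearMap.eq_adjoint_iff _ _).mpr fun h k => ?_
        simp only [PiLp.inner_apply, diagCLM_apply]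
        exact Finset.sum_congr rfl fun j _ => by rw [rep_star_inner, star_star] }

variable {N} {R}

/-- The coordinate projection `R^{(N)} → R`. -/
noncomputable def coord (j : Fin N) : Intertwiner (copies N R) R :=
  ⟨PiLp.proj (𝕜 := ℂ) 2 (fun _ : Fin N => (R : Type u)) j, fun _ => rfl⟩

/-- The inclusion `R → R^{(N)}` of the `j`-th summand. -/
noncomputable def incl (j : Fin N) : Intertwiner R (copies N R) :=
  Intertwiner.adj (coord j)

lemma single_inner (j : Fin N) (x : R) (h : CopySpace N R) :
    inner ℂ (PiLp.single 2 j x : CopySpace N R) h = inner ℂ x (h j) := by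
  rw [PiLp.inner_apply, Finset.sum_eq_single j]
  · simp
  · intro i _ hi
    simp [hi]
  · simp

lemma single_coord (i j : Fin N) (x : R) :
    (PiLp.single 2 j x : CopySpace N R) i = if i = j then x else 0 := by
  split_ifs with h
  · subst h; simp
  · simp [h]

lemma incl_eq (j : Fin N) (x : R) : (incl j).1 x = (PiLp.single 2 j x : CopySpace N R) :=
  ext_inner_right ℂ fun h =>
    (ContinuousLinearMap.adjoint_inner_left _ _ _).trans (single_inner j x h).symm

lemma incl_apply (j i : Fin N) (x : R) :
    (coord i).1 ((incl j).1 x) = if i = j then x else 0 := by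
  rw [incl_eq]
  exact single_coord i j x

lemma norm_incl_le (j : Fin N) : ‖(incl j : Intertwiner R (copies N R))‖ ≤ 1 := by
  have h1 : ‖(coord j : Intertwiner (copies N R) R)‖ ≤ 1 :=
    ContinuousLinearMap.opNorm_le_bound _ zero_le_one fun h => by
      rw [one_mul]; exact PiLp.norm_apply_le (h : CopySpace N R) j
  exact (LinearIsometryEquiv.norm_map ContinuousLinearMap.adjoint _).trans_le h1

lemma coord_incl_ne {i j : Fin N} (h : i ≠ j) :
    Intertwiner.comp (Intertwiner.adj (incl i)) (incl j) = (0 : Intertwiner R R) := by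
  apply Subtype.ext
  refine ContinuousLinearMap.ext fun x => ?_
  change ((coord i).1.adjoint.adjoint) ((incl j).1 x) = 0
  rw [ContinuousLinearMap.adjoint_adjoint, incl_apply, if_neg h]

end Copies

section Displacement

variable {M : Type v} {E : Type u} [CStarAlgebra M] [PartialOrder M] [StarOrderedRing M]
  [NormedAddCommGroup E] [NormedSpace ℂ E] [Module Mᵐᵒᵖ E] [CStarModule Mᵐᵒᵖ E]
  [Correspondence M E] {R : HilbRep.{u} M} {N : ℕ}

/-- The diagonal operator `z = diag(z_1, …, z_N)` from `R^{(N)}` to `E ⊗ R^{(N)} = (E ⊗ R)^{(N)}`;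
the `j`-th summand `E ⊗ R` is included in `E ⊗ R^{(N)}` by `I_E ⊗ ι_j`. -/
noncomputable def zDiag (z : Fin N → Intertwiner R (tens E R)) :
    Intertwiner (copies N R) (tens E (copies N R)) :=
  ∑ j, Intertwiner.comp (ampl (incl j)) (Intertwiner.comp (z j) (coord j))

lemma norm_zDiag_lt_one (z : Fin N → Intertwiner R (tens E R)) (hz : ∀ j, ‖z j‖ < 1) :
    ‖zDiag z‖ < 1 := by
  obtain ⟨c, hc0, hc1, hc⟩ : ∃ c : ℝ, 0 ≤ c ∧ c < 1 ∧ ∀ j, ‖z j‖ ≤ c := by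
    rcases isEmpty_or_nonempty (Fin N) with h | h
    · exact ⟨0, le_rfl, one_pos, fun j => h.elim j⟩
    · obtain ⟨j, hj⟩ := Finite.exists_max fun j => ‖z j‖
      exact ⟨‖z j‖, norm_nonneg _, hz j, hj⟩
  refine lt_of_le_of_lt (ContinuousLinearMap.opNorm_le_bound _ hc0 fun h => ?_) hc1
  let w : Fin N → tens E (copies N R) := fun j =>
    (ampl (incl j)).1 ((z j).1 ((coord j).1 h))
  have hw : (zDiag z).1 h = ∑ j, w j := by
    simp only [zDiag, AddSubmonoidClass.coe_finsetSum, _root_.sum_apply]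
    rfl
  have h1 : ‖(zDiag z).1 h‖ ^ 2 = ∑ j, ‖w j‖ ^ 2 := by
    rw [← inner_self_eq_norm_sq (𝕜 := ℂ), hw, sum_inner, map_sum]
    refine Finset.sum_congr rfl fun i _ => ?_
    rw [inner_sum, Finset.sum_eq_single i, inner_self_eq_norm_sq]
    · intro j _ hj
      simp only [w]
      rw [inner_ampl, coord_incl_ne hj.symm]
      have h2 : ∀ v : tens E R, (ampl (E := E) (0 : Intertwiner R R)).1 v = 0 := fun v => by
        have := norm_ampl_le (E := E) (0 : Intertwiner R R)
        rw [norm_zero, norm_le_zero_iff] at this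
        rw [this]; rfl
      rw [h2, inner_zero_right]
    · simp
  have h3 : ∀ j, ‖w j‖ ≤ c * ‖(coord j).1 h‖ := fun j =>
    calc ‖w j‖ ≤ 1 * ‖(z j).1 ((coord j).1 h)‖ :=
          (ampl (E := E) (incl j)).1.le_of_opNorm_le ((norm_ampl_le _).trans (norm_incl_le j)) _
      _ ≤ 1 * (c * ‖(coord j).1 h‖) := by
          gcongr
          exact (z j).1.le_of_opNorm_le (hc j) _
      _ = c * ‖(coord j).1 h‖ := one_mul _
  change ‖(zDiag z).1 h‖ ≤ c * ‖h‖
  rw [← sq_le_sq₀ (norm_nonneg _) (by positivity), h1, mul_pow]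
  have h4 : ‖h‖ ^ 2 = ∑ j, ‖(coord j).1 h‖ ^ 2 :=
    PiLp.norm_sq_eq_of_L2 (fun _ : Fin N => (R : Type u)) h
  rw [h4, Finset.mul_sum]
  refine Finset.sum_le_sum fun j _ => ?_
  rw [← mul_pow]
  gcongr
  exact h3 j

/-- The column `U = [I, …, I]^T` from `R` to `R^{(N)}`. -/
noncomputable def colU (N : ℕ) (R : HilbRep.{u} M) : Intertwiner R (copies N R) := ∑ j, incl j

/-- The column `V = [Λ_1^*, …, Λ_N^*]^T` from `R` to `R^{(N)}`. -/
noncomputable def colV (Λ : Fin N → Intertwiner R R) : Intertwiner R (copies N R) :=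
  ∑ j, Intertwiner.comp (incl j) (Intertwiner.adj (Λ j))

/-- `A` in the commutant of `π^{(N)}(M)` solves the displacement equation
`A - z^* (I_E ⊗ A) z = U U^* - V V^*`. -/
def IsDisplacementSolution (z : Fin N → Intertwiner R (tens E R)) (Λ : Fin N → Intertwiner R R)
    (A : Intertwiner (copies N R) (copies N R)) : Prop :=
  A.1 - (zDiag z).1.adjoint ∘L (ampl (E := E) A).1 ∘L (zDiag z).1
    = (colU N R).1 ∘L (colU N R).1.adjoint - (colV Λ).1 ∘L (colV Λ).1.adjoint

/-- `U_∞ = [U^*, (I_E ⊗ U^*) z, (I_{E^{⊗ 2}} ⊗ U^*) z^{(2)}, …]^T = (I_{𝓕(E)} ⊗ U^*) C(z)`, from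
`R^{(N)}` to `𝓕(E) ⊗ R`. -/
noncomputable def Uinf (z : Fin N → Intertwiner R (tens E R)) (hz : ∀ j, ‖z j‖ < 1) :
    copies N R →L[ℂ] Fock E R :=
  fockAmpl (Intertwiner.adj (colU N R)) ∘L cauchy (zDiag z) (norm_zDiag_lt_one z hz)

/-- `V_∞ = [V^*, (I_E ⊗ V^*) z, (I_{E^{⊗ 2}} ⊗ V^*) z^{(2)}, …]^T = (I_{𝓕(E)} ⊗ V^*) C(z)`, from
`R^{(N)}` to `𝓕(E) ⊗ R`. -/
noncomputable def Vinf (z : Fin N → Intertwiner R (tens E R)) (hz : ∀ j, ‖z j‖ < 1)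
    (Λ : Fin N → Intertwiner R R) : copies N R →L[ℂ] Fock E R :=
  fockAmpl (Intertwiner.adj (colV Λ)) ∘L cauchy (zDiag z) (norm_zDiag_lt_one z hz)

/-- The Pick matrix with entries
`⟨C(z_i), C(z_j)⟩ - ⟨(I_{𝓕(E)} ⊗ Λ_i) C(z_i), (I_{𝓕(E)} ⊗ Λ_j) C(z_j)⟩`, where `⟨X, Y⟩ = X^* Y`. -/
noncomputable def pickMatrix (z : Fin N → Intertwiner R (tens E R)) (hz : ∀ j, ‖z j‖ < 1)
    (Λ : Fin N → Intertwiner R R) : Matrix (Fin N) (Fin N) (R →L[ℂ] R) :=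
  Matrix.of fun i j =>
    (cauchy (z i) (hz i)).adjoint ∘L cauchy (z j) (hz j)
      - (fockAmpl (E := E) (Λ i) ∘L cauchy (z i) (hz i)).adjoint ∘L
        (fockAmpl (E := E) (Λ j) ∘L cauchy (z j) (hz j))

/-- The block matrix `[A_ij]` of an operator `A` on `R^{(N)}`. -/
noncomputable def blocks (A : copies N R →L[ℂ] copies N R) :
    Matrix (Fin N) (Fin N) (R →L[ℂ] R) :=
  Matrix.of fun i j => (coord i).1 ∘L A ∘L (incl j).1

/-- The Hilbert space `H` with the representation `σ`. -/
noncomputable def ofRep {H : Type u} [NormedAddCommGroup H] [InnerProductSpace ℂ H]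
    [CompleteSpace H] (σ : M →⋆ₐ[ℂ] (H →L[ℂ] H)) : HilbRep.{u} M where
  carrier := H
  rep := σ.toNonUnitalStarAlgHom

/-- The `σ`-dual `E^σ = 𝔍(σ, σ^E ∘ φ)` of `E`. -/
noncomputable abbrev SigmaDual (E : Type u) [NormedAddCommGroup E] [NormedSpace ℂ E] [Module Mᵐᵒᵖ E]
    [CStarModule Mᵐᵒᵖ E] [Correspondence M E] {H : Type u} [NormedAddCommGroup H]
    [InnerProductSpace ℂ H] [CompleteSpace H] (σ : M →⋆ₐ[ℂ] (H →L[ℂ] H)) :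
    Submodule ℂ (ofRep σ →L[ℂ] tens E (ofRep σ)) :=
  Intertwiner (ofRep σ) (tens E (ofRep σ))

/-- The commutant `σ(M)'` in `B(H)`. -/
noncomputable abbrev Commutant {H : Type u} [NormedAddCommGroup H]
    [InnerProductSpace ℂ H] [CompleteSpace H] (σ : M →⋆ₐ[ℂ] (H →L[ℂ] H)) :
    Submodule ℂ (ofRep σ →L[ℂ] ofRep σ) :=
  Intertwiner (ofRep σ) (ofRep σ)

end Displacement

end WCorr

/-!
The displacement equation `A - z* (I_E ⊗ A) z = U U* - V V*` is a fixed point equation for the map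
`X ↦ U U* - V V* + z* (I_E ⊗ X) z`. Since `‖z‖ < 1`, this map is a strict contraction of the
commutant, which is complete in the operator norm; hence there is exactly one solution
(`existsUnique_stein`). Iterating the equation expands the solution into
`∑ z^{(k)}* (I_{E^{⊗ k}} ⊗ (U U* - V V*)) z^{(k)}`, which says that
`A = U_∞* U_∞ - V_∞* V_∞` (`inner_of_stein`). The Cauchy kernel of `diag(z_1, …, z_N)` restricts to
that of `z_j` on the `j`-th summand, so the blocks of `A` are those of the Pick matrix.

If a contraction `T` satisfies `T U_∞ = V_∞`, then `A = U_∞* (I - T* T) U_∞ ≥ 0`.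

Conversely, let `A ≥ 0`, and let `B` be its square root, which lies in the commutant. The
displacement equation becomes `B* B + V V* = z* (I_E ⊗ B)* (I_E ⊗ B) z + U U*`: the columns
`[(I_E ⊗ B) z; U*]` and `[B; V*]` have the same Gram operator. The isometry between their ranges
commutes with `M`, and extending it by zero makes it a contractive intertwiner
`W : (E ⊗ H^{(N)}) ⊕ H → H^{(N)} ⊕ H` (`exists_blockContraction`). Let `a`, `b`, `c`, `d` be the
entries of `W*`. They define a linear system whose time-`k` coefficients are amplified by
`I_{E^{⊗ k}}`:
`x_{k+1} = (I ⊗ a) x_k + (I ⊗ c) f_k`, `y_k = (I ⊗ b) x_k + (I ⊗ d) f_k`, `x_0 = 0`.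
Amplification preserves contractivity of the block matrix (`BlockContraction.ampl`), so
`‖x_{k+1}‖² + ‖y_k‖² ≤ ‖x_k‖² + ‖f_k‖²`, and `f ↦ y` is a contraction of the Fock space
(`ioMap`). Its matrix is lower triangular and Toeplitz, so its adjoint `T` is of Schur class
(`isSchur_adjoint_ioMap`). For the adjoint the recursion runs forward in time from
`x_0 = 0`, so the system has an output for every `f`. Finally the amplified relation between
the columns makes the difference of `⟨f, V_∞ h⟩` and `⟨y, U_∞ h⟩` a telescoping series with sum
zero, which is `T U_∞ = V_∞` (`inner_ioMap_cauchy`).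
-/

namespace WCorr

open scoped InnerProductSpace

/-! ### Adjoints of intertwiners -/

section Adjoint

variable {M : Type v} [CStarAlgebra M] {R S Q : HilbRep.{u} M}

lemma Intertwiner.adj_inner_right (T : Intertwiner R S) (x : R) (y : S) :
    inner ℂ x ((Intertwiner.adj T).1 y) = inner ℂ (T.1 x) y :=
  ContinuousLinearMap.adjoint_inner_right _ _ _

lemma Intertwiner.adj_inner_left (T : Intertwiner R S) (x : R) (y : S) :
    inner ℂ ((Intertwiner.adj T).1 y) x = inner ℂ y (T.1 x) :=
  ContinuousLinearMap.adjoint_inner_left _ _ _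

lemma Intertwiner.adj_adj (T : Intertwiner R S) : Intertwiner.adj (Intertwiner.adj T) = T :=
  Subtype.ext (ContinuousLinearMap.adjoint_adjoint _)

lemma Intertwiner.adj_comp (T : Intertwiner S Q) (T' : Intertwiner R S) :
    Intertwiner.adj (Intertwiner.comp T T')
      = Intertwiner.comp (Intertwiner.adj T') (Intertwiner.adj T) :=
  Subtype.ext (ContinuousLinearMap.adjoint_comp _ _)

end Adjoint

/-! ### Functoriality of `T ↦ I_E ⊗ T` -/

section Functoriality

variable {M : Type v} {E : Type u} [CStarAlgebra M] [PartialOrder M] [StarOrderedRing M]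
  [NormedAddCommGroup E] [NormedSpace ℂ E] [Module Mᵐᵒᵖ E] [CStarModule Mᵐᵒᵖ E]
  [Correspondence M E] {R S Q : HilbRep.{u} M}

lemma tmul_add_right (ξ : E) (x y : R) : tmul ξ (x + y) = tmul ξ x + tmul ξ y :=
  (tmulCLM ξ).map_add x y

lemma tmul_sub_right (ξ : E) (x y : R) : tmul ξ (x - y) = tmul ξ x - tmul ξ y :=
  (tmulCLM ξ).map_sub x y

lemma tmul_zero_right (ξ : E) : tmul ξ (0 : R) = 0 :=
  (tmulCLM ξ).map_zero

lemma ampl_comp (T : Intertwiner S Q) (T' : Intertwiner R S) :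
    ampl (E := E) (Intertwiner.comp T T') = Intertwiner.comp (ampl T) (ampl T') := by
  refine Subtype.ext (tens_ext fun ξ x => ?_)
  change (ampl (Intertwiner.comp T T')).1 (tmul ξ x) = (ampl T).1 ((ampl T').1 (tmul ξ x))
  rw [ampl_tmul, ampl_tmul, ampl_tmul]
  rfl

lemma ampl_add (T T' : Intertwiner R S) : ampl (E := E) (T + T') = ampl T + ampl T' := by
  refine Subtype.ext (tens_ext fun ξ x => ?_)
  change (ampl (T + T')).1 (tmul ξ x) = (ampl T).1 (tmul ξ x) + (ampl T').1 (tmul ξ x)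
  rw [ampl_tmul, ampl_tmul, ampl_tmul]
  exact tmul_add_right ξ (T.1 x) (T'.1 x)

lemma ampl_sub (T T' : Intertwiner R S) : ampl (E := E) (T - T') = ampl T - ampl T' := by
  refine Subtype.ext (tens_ext fun ξ x => ?_)
  change (ampl (T - T')).1 (tmul ξ x) = (ampl T).1 (tmul ξ x) - (ampl T').1 (tmul ξ x)
  rw [ampl_tmul, ampl_tmul, ampl_tmul]
  exact tmul_sub_right ξ (T.1 x) (T'.1 x)

lemma ampl_zero : ampl (E := E) (0 : Intertwiner R S) = 0 := by
  refine Subtype.ext (tens_ext fun ξ x => ?_)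
  rw [ampl_tmul]
  exact tmul_zero_right ξ

lemma ampl_id : ampl (E := E) (Intertwiner.id R) = Intertwiner.id (tens E R) := by
  refine Subtype.ext (tens_ext fun ξ x => ?_)
  rw [ampl_tmul]
  rfl

lemma ampl_adj (T : Intertwiner R S) :
    ampl (E := E) (Intertwiner.adj T) = Intertwiner.adj (ampl T) := by
  refine Subtype.ext (ContinuousLinearMap.ext fun w => ext_inner_left ℂ fun z => ?_)
  rw [Intertwiner.adj_inner_right]
  have h := inner_ampl (E := E) T (Intertwiner.id S) z w
  rw [ampl_id] at h
  exact h.symm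

end Functoriality

/-! ### Orthogonal sums of representations and block operators -/

section DirectSum

variable {M : Type v} [CStarAlgebra M] (R S : HilbRep.{u} M)

/-- The Hilbert space sum of two spaces, with the `ℓ²` norm. -/
abbrev SumSpace : Type u := WithLp 2 (R.carrier × S.carrier)

/-- The operator `A ⊕ B` on the Hilbert space sum of two spaces. -/
noncomputable def sumCLM (A : R →L[ℂ] R) (B : S →L[ℂ] S) :
    SumSpace R S →L[ℂ] SumSpace R S :=
  (WithLp.prodContinuousLinearEquiv 2 ℂ R S).symm.toContinuousLinearMap ∘L
    A.prodMap B ∘L (WithLp.prodContinuousLinearEquiv 2 ℂ R S).toContinuousLinearMap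

lemma sumCLM_apply (A : R →L[ℂ] R) (B : S →L[ℂ] S) (x : SumSpace R S) :
    sumCLM R S A B x = WithLp.toLp 2 (A x.fst, B x.snd) := rfl

/-- The orthogonal sum `R ⊕ S` of two representations. -/
noncomputable def dsum : HilbRep.{u} M where
  carrier := SumSpace R S
  rep :=
    { toFun := fun a => sumCLM R S (R.rep a) (S.rep a)
      map_smul' := fun c a => by
        refine ContinuousLinearMap.ext fun x => ?_
        simp [sumCLM_apply, ← WithLp.toLp_smul]
      map_zero' := by
        refine ContinuousLinearMap.ext fun x => ?_
        simp [sumCLM_apply]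
      map_add' := fun a b => by
        refine ContinuousLinearMap.ext fun x => ?_
        simp [sumCLM_apply, ← WithLp.toLp_add]
      map_mul' := fun a b => by
        refine ContinuousLinearMap.ext fun x => ?_
        simp [sumCLM_apply]
      map_star' := fun a => by
        rw [ContinuousLinearMap.star_eq_adjoint]
        refine (ContinuousLinearMap.eq_adjoint_iff _ _).mpr fun x y => ?_
        simp only [sumCLM_apply, WithLp.prod_inner_apply]
        exact congrArg₂ (· + ·) ((rep_star_inner R _ _ _).trans (by rw [star_star]; rfl))
          ((rep_star_inner S _ _ _).trans (by rw [star_star]; rfl)) }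

variable {R S}

/-- The projection `R ⊕ S → R`. -/
noncomputable def dfst : Intertwiner (dsum R S) R :=
  ⟨WithLp.fstL 2 ℂ (R : Type u) (S : Type u), fun _ => rfl⟩

/-- The projection `R ⊕ S → S`. -/
noncomputable def dsnd : Intertwiner (dsum R S) S :=
  ⟨WithLp.sndL 2 ℂ (R : Type u) (S : Type u), fun _ => rfl⟩

/-- The inclusion `R → R ⊕ S`. -/
noncomputable def dinl : Intertwiner R (dsum R S) := Intertwiner.adj dfst

/-- The inclusion `S → R ⊕ S`. -/
noncomputable def dinr : Intertwiner S (dsum R S) := Intertwiner.adj dsnd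

lemma toLp_inl_inner (x : R) (h : SumSpace R S) :
    inner ℂ (WithLp.toLp 2 (x, 0) : SumSpace R S) h = inner ℂ x h.fst := by
  simp [WithLp.prod_inner_apply]

lemma toLp_inr_inner (x : S) (h : SumSpace R S) :
    inner ℂ (WithLp.toLp 2 (0, x) : SumSpace R S) h = inner ℂ x h.snd := by
  simp [WithLp.prod_inner_apply]

lemma dinl_eq (x : R) :
    (dinl : Intertwiner R (dsum R S)).1 x
      = (WithLp.toLp 2 (x, 0) : SumSpace R S) :=
  ext_inner_right ℂ fun h =>
    (ContinuousLinearMap.adjoint_inner_left _ _ _).trans (toLp_inl_inner x h).symm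

lemma dinr_eq (x : S) :
    (dinr : Intertwiner S (dsum R S)).1 x
      = (WithLp.toLp 2 (0, x) : SumSpace R S) :=
  ext_inner_right ℂ fun h =>
    (ContinuousLinearMap.adjoint_inner_left _ _ _).trans (toLp_inr_inner x h).symm

lemma dfst_comp_dinl :
    Intertwiner.comp (dfst : Intertwiner (dsum R S) R) dinl = Intertwiner.id R := by
  refine Subtype.ext (ContinuousLinearMap.ext fun x => ?_)
  change (dfst : Intertwiner (dsum R S) R).1 (dinl.1 x) = x
  rw [dinl_eq]
  rfl

lemma dsnd_comp_dinl :
    Intertwiner.comp (dsnd : Intertwiner (dsum R S) S) dinl = 0 := by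
  refine Subtype.ext (ContinuousLinearMap.ext fun x => ?_)
  change (dsnd : Intertwiner (dsum R S) S).1 (dinl.1 x) = 0
  rw [dinl_eq]
  rfl

lemma dsnd_comp_dinr :
    Intertwiner.comp (dsnd : Intertwiner (dsum R S) S) dinr = Intertwiner.id S := by
  refine Subtype.ext (ContinuousLinearMap.ext fun x => ?_)
  change (dsnd : Intertwiner (dsum R S) S).1 (dinr.1 x) = x
  rw [dinr_eq]
  rfl

lemma dfst_comp_dinr :
    Intertwiner.comp (dfst : Intertwiner (dsum R S) R) dinr = 0 := by
  refine Subtype.ext (ContinuousLinearMap.ext fun x => ?_)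
  change (dfst : Intertwiner (dsum R S) R).1 (dinr.1 x) = 0
  rw [dinr_eq]
  rfl

lemma dsum_norm_sq (v : dsum R S) : ‖v‖ ^ 2 = ‖dfst.1 v‖ ^ 2 + ‖dsnd.1 v‖ ^ 2 :=
  WithLp.prod_norm_sq_eq_of_L2 (v : SumSpace R S)

/-- The block matrix `[a c; b d]` of intertwiners satisfies `‖a x + c y‖² + ‖b x + d y‖² ≤
‖x‖² + ‖y‖²`, that is, it is a contraction from `R ⊕ S` to `R' ⊕ S'`. -/
def BlockContraction {R S R' S' : HilbRep.{u} M} (a : Intertwiner R R') (c : Intertwiner S R')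
    (b : Intertwiner R S') (d : Intertwiner S S') : Prop :=
  ∀ (x : R) (y : S), ‖a.1 x + c.1 y‖ ^ 2 + ‖b.1 x + d.1 y‖ ^ 2 ≤ ‖x‖ ^ 2 + ‖y‖ ^ 2

variable {E : Type u} [PartialOrder M] [StarOrderedRing M]
  [NormedAddCommGroup E] [NormedSpace ℂ E] [Module Mᵐᵒᵖ E] [CStarModule Mᵐᵒᵖ E]
  [Correspondence M E]

lemma ampl_dsum_norm_sq (x : tens E R) (y : tens E S) :
    ‖(ampl (E := E) (dinl : Intertwiner R (dsum R S))).1 x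
      + (ampl (E := E) (dinr : Intertwiner S (dsum R S))).1 y‖ ^ 2 = ‖x‖ ^ 2 + ‖y‖ ^ 2 := by
  have hadj1 : Intertwiner.adj (dinl : Intertwiner R (dsum R S)) = dfst :=
    Intertwiner.adj_adj _
  have hadj2 : Intertwiner.adj (dinr : Intertwiner S (dsum R S)) = dsnd :=
    Intertwiner.adj_adj _
  have h1 : ‖(ampl (E := E) (dinl : Intertwiner R (dsum R S))).1 x‖ ^ 2 = ‖x‖ ^ 2 := by
    rw [← inner_self_eq_norm_sq (𝕜 := ℂ), inner_ampl, hadj1, dfst_comp_dinl, ampl_id]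
    exact inner_self_eq_norm_sq x
  have h2 : ‖(ampl (E := E) (dinr : Intertwiner S (dsum R S))).1 y‖ ^ 2 = ‖y‖ ^ 2 := by
    rw [← inner_self_eq_norm_sq (𝕜 := ℂ), inner_ampl, hadj2, dsnd_comp_dinr, ampl_id]
    exact inner_self_eq_norm_sq y
  have h3 : inner ℂ ((ampl (E := E) (dinl : Intertwiner R (dsum R S))).1 x)
      ((ampl (E := E) (dinr : Intertwiner S (dsum R S))).1 y) = 0 := by
    rw [inner_ampl, hadj1, dfst_comp_dinr, ampl_zero]
    exact inner_zero_right _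
  rw [norm_add_sq (𝕜 := ℂ), h1, h2, h3]
  simp

/-- Amplification by `I_E` preserves block contractions, because `E ⊗ (R ⊕ S)` is the orthogonal
sum of `E ⊗ R` and `E ⊗ S`. -/
lemma BlockContraction.ampl {R S R' S' : HilbRep.{u} M} {a : Intertwiner R R'}
    {c : Intertwiner S R'} {b : Intertwiner R S'} {d : Intertwiner S S'}
    (h : BlockContraction a c b d) :
    BlockContraction (ampl (E := E) a) (WCorr.ampl c) (WCorr.ampl b) (WCorr.ampl d) := by
  intro x y
  let r : Intertwiner (dsum R S) R' := Intertwiner.comp a dfst + Intertwiner.comp c dsnd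
  let s : Intertwiner (dsum R S) S' := Intertwiner.comp b dfst + Intertwiner.comp d dsnd
  let W : Intertwiner (dsum R S) (dsum R' S') := Intertwiner.comp dinl r + Intertwiner.comp dinr s
  have hW : ‖W‖ ≤ 1 := by
    refine ContinuousLinearMap.opNorm_le_bound _ zero_le_one fun v => ?_
    have h1 : W.1 v = (WithLp.toLp 2 (r.1 v, s.1 v) : SumSpace R' S') := by
      change dinl.1 (r.1 v) + dinr.1 (s.1 v) = _
      rw [dinl_eq, dinr_eq]
      refine (WithLp.toLp_add 2 _ _).symm.trans ?_
      rw [Prod.mk_add_mk, add_zero, zero_add]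
    have h2 : ‖W.1 v‖ ^ 2 = ‖r.1 v‖ ^ 2 + ‖s.1 v‖ ^ 2 := by
      rw [dsum_norm_sq, h1]; rfl
    rw [one_mul]
    change ‖W.1 v‖ ≤ ‖v‖
    rw [← sq_le_sq₀ (norm_nonneg _) (norm_nonneg _), h2, dsum_norm_sq v]
    exact h _ _
  have hr1 : Intertwiner.comp r dinl = a := by
    refine Subtype.ext (ContinuousLinearMap.ext fun x => ?_)
    change a.1 ((Intertwiner.comp dfst dinl).1 x) + c.1 ((Intertwiner.comp dsnd dinl).1 x) = a.1 x
    rw [dfst_comp_dinl, dsnd_comp_dinl]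
    change a.1 x + c.1 0 = a.1 x
    rw [map_zero, add_zero]
  have hr2 : Intertwiner.comp r dinr = c := by
    refine Subtype.ext (ContinuousLinearMap.ext fun x => ?_)
    change a.1 ((Intertwiner.comp dfst dinr).1 x) + c.1 ((Intertwiner.comp dsnd dinr).1 x) = c.1 x
    rw [dsnd_comp_dinr, dfst_comp_dinr]
    change a.1 0 + c.1 x = c.1 x
    rw [map_zero, zero_add]
  have hs1 : Intertwiner.comp s dinl = b := by
    refine Subtype.ext (ContinuousLinearMap.ext fun x => ?_)
    change b.1 ((Intertwiner.comp dfst dinl).1 x) + d.1 ((Intertwiner.comp dsnd dinl).1 x) = b.1 x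
    rw [dfst_comp_dinl, dsnd_comp_dinl]
    change b.1 x + d.1 0 = b.1 x
    rw [map_zero, add_zero]
  have hs2 : Intertwiner.comp s dinr = d := by
    refine Subtype.ext (ContinuousLinearMap.ext fun x => ?_)
    change b.1 ((Intertwiner.comp dfst dinr).1 x) + d.1 ((Intertwiner.comp dsnd dinr).1 x) = d.1 x
    rw [dsnd_comp_dinr, dfst_comp_dinr]
    change b.1 0 + d.1 x = d.1 x
    rw [map_zero, zero_add]
  let v : tens E (dsum R S) := (WCorr.ampl (E := E) dinl).1 x + (WCorr.ampl (E := E) dinr).1 y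
  have hrv : (WCorr.ampl (E := E) r).1 v = (WCorr.ampl a).1 x + (WCorr.ampl c).1 y := by
    conv_rhs => rw [← hr1, ← hr2, ampl_comp, ampl_comp]
    exact map_add _ _ _
  have hsv : (WCorr.ampl (E := E) s).1 v = (WCorr.ampl b).1 x + (WCorr.ampl d).1 y := by
    conv_rhs => rw [← hs1, ← hs2, ampl_comp, ampl_comp]
    exact map_add _ _ _
  have hWv : (WCorr.ampl (E := E) W).1 v
      = (WCorr.ampl (E := E) dinl).1 ((WCorr.ampl a).1 x + (WCorr.ampl c).1 y)
        + (WCorr.ampl (E := E) dinr).1 ((WCorr.ampl b).1 x + (WCorr.ampl d).1 y) := by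
    rw [← hrv, ← hsv, ampl_add, ampl_comp, ampl_comp]
    rfl
  rw [← ampl_dsum_norm_sq, ← hWv, ← ampl_dsum_norm_sq]
  gcongr
  have := (WCorr.ampl (E := E) W).1.le_of_opNorm_le ((norm_ampl_le W).trans hW) v
  rwa [one_mul] at this

end DirectSum

/-! ### Lurking isometries -/

section Lurking

variable {M : Type v} [CStarAlgebra M]

/-- If intertwiners `F` and `G` satisfy `F* F = G* G`, then `F h ↦ G h` is isometric on the range
of `F`, and extending it by zero to the complement of that range gives a contractive intertwiner
`W` with `W F = G`. -/
lemma exists_contraction_comp_eq {K D D' : HilbRep.{u} M} (F : Intertwiner K D)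
    (G : Intertwiner K D') (h : ∀ x, ‖G.1 x‖ = ‖F.1 x‖) :
    ∃ W : Intertwiner D D', ‖W‖ ≤ 1 ∧ ∀ x, W.1 (F.1 x) = G.1 x := by
  let S : Submodule ℂ D := F.1.range.topologicalClosure
  have hmem : ∀ x, F.1 x ∈ S := fun x =>
    Submodule.le_topologicalClosure _ (LinearMap.mem_range_self _ x)
  let e : K →ₗ[ℂ] S := LinearMap.codRestrict S F.1.toLinearMap hmem
  have hdense : DenseRange e := by
    intro y
    rw [Metric.mem_closure_iff]
    intro ε hε
    obtain ⟨w, ⟨x, rfl⟩, hx⟩ := Metric.mem_closure_iff.mp y.2 ε hε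
    exact ⟨e x, ⟨x, rfl⟩, hx⟩
  have hnorm : ∀ x, ‖G.1.toLinearMap x‖ ≤ 1 * ‖e x‖ := fun x => by
    rw [one_mul]
    exact (h x).le
  let W₀ : S →L[ℂ] D' := G.1.toLinearMap.extendOfNorm e
  have hW₀ : ∀ x, W₀ (e x) = G.1 x := LinearMap.extendOfNorm_eq hdense ⟨1, hnorm⟩
  have : CompleteSpace S :=
    (Submodule.isClosed_topologicalClosure _).completeSpace_coe
  let W : D →L[ℂ] D' := W₀ ∘L S.orthogonalProjectionOnto
  have hWe : ∀ s : S, W s = W₀ s := fun s => by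
    change W₀ (S.orthogonalProjectionOnto s) = W₀ s
    rw [Submodule.orthogonalProjectionOnto_mem_subspace_eq_self]
  have hWF : ∀ x, W (F.1 x) = G.1 x := fun x => (hWe (e x)).trans (hW₀ x)
  -- the closed range of `F` reduces the representation
  have hinv : ∀ (a : M) (v : D), v ∈ S → D.rep a v ∈ S := by
    intro a v hv
    have hle : S ≤ S.comap (D.rep a).toLinearMap := by
      refine Submodule.topologicalClosure_minimal _ ?_
        ((Submodule.isClosed_topologicalClosure _).preimage (D.rep a).continuous)
      rintro _ ⟨x, rfl⟩
      change D.rep a (F.1 x) ∈ S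
      rw [← apply_rep F]
      exact hmem _
    exact hle hv
  have hinv' : ∀ (a : M) (v : D), v ∈ Sᗮ → D.rep a v ∈ Sᗮ := by
    intro a v hv
    rw [Submodule.mem_orthogonal'] at hv ⊢
    intro s hs
    rw [rep_star_inner]
    exact hv _ (hinv _ _ hs)
  have hWperp : ∀ v ∈ Sᗮ, W v = 0 := fun v hv => by
    change W₀ (S.orthogonalProjectionOnto v) = 0
    rw [Submodule.orthogonalProjectionOnto_apply_of_mem_orthogonal hv, map_zero]
  have hWS : ∀ (a : M) (s : D), s ∈ S → W (D.rep a s) = D'.rep a (W s) := by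
    intro a s hs
    have hle : S ≤ LinearMap.eqLocus (W ∘L D.rep a).toLinearMap (D'.rep a ∘L W).toLinearMap := by
      refine Submodule.topologicalClosure_minimal _ ?_
        (isClosed_eq (W ∘L D.rep a).continuous (D'.rep a ∘L W).continuous)
      rintro _ ⟨x, rfl⟩
      change W (D.rep a (F.1 x)) = D'.rep a (W (F.1 x))
      rw [← apply_rep F, hWF, hWF, apply_rep G]
    exact hle hs
  refine ⟨⟨W, fun a => ContinuousLinearMap.ext fun v => ?_⟩, ?_, hWF⟩
  · obtain ⟨s, hs, t, ht, rfl⟩ := S.exists_add_mem_mem_orthogonal v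
    change W (D.rep a (s + t)) = D'.rep a (W (s + t))
    rw [map_add, map_add, map_add, map_add, hWS a s hs, hWperp _ (hinv' a t ht), hWperp t ht,
      map_zero]
  · refine ContinuousLinearMap.opNorm_le_bound _ zero_le_one fun v => ?_
    calc ‖W₀ (S.orthogonalProjectionOnto v)‖ ≤ 1 * ‖S.orthogonalProjectionOnto v‖ :=
          LinearMap.norm_extendOfNorm_apply_le hdense 1 hnorm _
      _ ≤ 1 * ‖v‖ := by
          gcongr
          exact Submodule.norm_orthogonalProjectionOnto_apply_le S v

variable {K P P' S S' : HilbRep.{u} M}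

lemma dfst_add (x : P) (y : S) : dfst.1 ((dinl : Intertwiner P (dsum P S)).1 x + dinr.1 y) = x := by
  rw [map_add, dinl_eq, dinr_eq]
  exact add_zero x

lemma dsnd_add (x : P) (y : S) : dsnd.1 ((dinl : Intertwiner P (dsum P S)).1 x + dinr.1 y) = y := by
  rw [map_add, dinl_eq, dinr_eq]
  exact zero_add y

lemma dsum_norm_add_sq (x : P) (y : S) :
    ‖(dinl : Intertwiner P (dsum P S)).1 x + dinr.1 y‖ ^ 2 = ‖x‖ ^ 2 + ‖y‖ ^ 2 := by
  rw [dsum_norm_sq, dfst_add, dsnd_add]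

/-- The lurking isometry argument in block form: if the columns `[f; g]` and `[f'; g']` have the
same Gram operator, then some contraction `[a c; b d]` has an adjoint that maps the first column
to the second. -/
lemma exists_blockContraction (f : Intertwiner K P) (g : Intertwiner K S) (f' : Intertwiner K P')
    (g' : Intertwiner K S')
    (h : ∀ x, ‖f'.1 x‖ ^ 2 + ‖g'.1 x‖ ^ 2 = ‖f.1 x‖ ^ 2 + ‖g.1 x‖ ^ 2) :
    ∃ (a : Intertwiner P' P) (c : Intertwiner S' P) (b : Intertwiner P' S) (d : Intertwiner S' S),
      BlockContraction a c b d ∧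
      f' = Intertwiner.comp (Intertwiner.adj a) f + Intertwiner.comp (Intertwiner.adj b) g ∧
      g' = Intertwiner.comp (Intertwiner.adj c) f + Intertwiner.comp (Intertwiner.adj d) g := by
  let F : Intertwiner K (dsum P S) := Intertwiner.comp dinl f + Intertwiner.comp dinr g
  let G : Intertwiner K (dsum P' S') := Intertwiner.comp dinl f' + Intertwiner.comp dinr g'
  obtain ⟨W, hW, hWF⟩ := exists_contraction_comp_eq F G fun x => by
    rw [← sq_eq_sq₀ (norm_nonneg _) (norm_nonneg _)]
    exact (dsum_norm_add_sq _ _).trans ((h x).trans (dsum_norm_add_sq _ _).symm)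
  let V : Intertwiner (dsum P' S') (dsum P S) := Intertwiner.adj W
  have hV : ∀ v, ‖V.1 v‖ ≤ ‖v‖ := fun v => by
    have h1 : ‖V.1‖ ≤ 1 := (LinearIsometryEquiv.norm_map ContinuousLinearMap.adjoint _).trans_le hW
    have h2 := V.1.le_of_opNorm_le h1 v
    rwa [one_mul] at h2
  -- an entry of the adjoint of `V = W*` is an entry of `W`
  have hadj : ∀ {X X' : HilbRep.{u} M} (p : Intertwiner (dsum P S) X)
      (q : Intertwiner X' (dsum P' S')) (x : X),
      (Intertwiner.adj (Intertwiner.comp p (Intertwiner.comp V q))).1 x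
        = (Intertwiner.adj q).1 (W.1 ((Intertwiner.adj p).1 x)) := by
    intro X X' p q x
    rw [Intertwiner.adj_comp, Intertwiner.adj_comp, Intertwiner.adj_adj]
    rfl
  have hfst : Intertwiner.adj (dinl : Intertwiner P' (dsum P' S')) = dfst := Intertwiner.adj_adj _
  have hsnd : Intertwiner.adj (dinr : Intertwiner S' (dsum P' S')) = dsnd := Intertwiner.adj_adj _
  refine ⟨Intertwiner.comp dfst (Intertwiner.comp V dinl),
    Intertwiner.comp dfst (Intertwiner.comp V dinr),
    Intertwiner.comp dsnd (Intertwiner.comp V dinl),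
    Intertwiner.comp dsnd (Intertwiner.comp V dinr), fun x y => ?_,
    Subtype.ext (ContinuousLinearMap.ext fun x => ?_),
    Subtype.ext (ContinuousLinearMap.ext fun x => ?_)⟩
  · have h1 := hV (dinl.1 x + dinr.1 y)
    rw [← sq_le_sq₀ (norm_nonneg _) (norm_nonneg _), dsum_norm_add_sq, dsum_norm_sq, map_add,
      map_add, map_add] at h1
    exact h1
  · have h1 : dfst.1 (W.1 (F.1 x)) = f'.1 x := by
      rw [hWF]
      exact dfst_add _ _
    refine h1.symm.trans ?_
    refine .trans ?_ (congrArg₂ (· + ·) (hadj dfst dinl (f.1 x))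
      (hadj dsnd dinl (g.1 x))).symm
    rw [hfst]
    change dfst.1 (W.1 (dinl.1 (f.1 x) + dinr.1 (g.1 x))) = _
    rw [map_add, map_add]
    rfl
  · have h1 : dsnd.1 (W.1 (F.1 x)) = g'.1 x := by
      rw [hWF]
      exact dsnd_add _ _
    refine h1.symm.trans ?_
    refine .trans ?_ (congrArg₂ (· + ·) (hadj dfst dinr (f.1 x))
      (hadj dsnd dinr (g.1 x))).symm
    rw [hsnd]
    change dsnd.1 (W.1 (dinl.1 (f.1 x) + dinr.1 (g.1 x))) = _
    rw [map_add, map_add]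
    rfl

/-- A positive operator in the commutant is `B* B` with `B` in the commutant, since its square root
commutes with everything it commutes with. -/
lemma exists_sqrt_intertwiner (A : Intertwiner K K) (hA : A.1.IsPositive) :
    ∃ B : Intertwiner K K, Intertwiner.comp (Intertwiner.adj B) B = A := by
  have hA0 : 0 ≤ A.1 := (ContinuousLinearMap.nonneg_iff_isPositive _).mpr hA
  have hcomm : ∀ a, Commute (CFC.sqrt A.1) (K.rep a) := by
    intro a
    have h : Commute A.1 (K.rep a) := A.2 a
    rw [CFC.sqrt_eq_cfc]
    exact h.cfc_nnreal _
  have hs : IsSelfAdjoint (CFC.sqrt A.1) := (CFC.sqrt_nonneg A.1).isSelfAdjoint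
  refine ⟨⟨CFC.sqrt A.1, hcomm⟩, Subtype.ext ?_⟩
  change ContinuousLinearMap.adjoint (CFC.sqrt A.1) * CFC.sqrt A.1 = A.1
  rw [← ContinuousLinearMap.star_eq_adjoint, hs.star_eq, CFC.sqrt_mul_sqrt_self A.1 hA0]

end Lurking

/-! ### Amplification by `I_{E^{⊗ k}}` -/

section Powers

variable {M : Type v} {E : Type u} [CStarAlgebra M] [PartialOrder M] [StarOrderedRing M]
  [NormedAddCommGroup E] [NormedSpace ℂ E] [Module Mᵐᵒᵖ E] [CStarModule Mᵐᵒᵖ E]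
  [Correspondence M E] {R S Q : HilbRep.{u} M}

lemma amplPow_comp (T : Intertwiner S Q) (T' : Intertwiner R S) (k : ℕ) :
    amplPow (E := E) (Intertwiner.comp T T') k
      = Intertwiner.comp (amplPow T k) (amplPow T' k) := by
  induction k with
  | zero => rfl
  | succ k ih =>
    exact (congrArg (fun X => ampl (E := E) X) ih).trans
      (ampl_comp (amplPow (E := E) T k) (amplPow (E := E) T' k))

lemma amplPow_sub (T T' : Intertwiner R S) (k : ℕ) :
    amplPow (E := E) (T - T') k = amplPow T k - amplPow T' k := by
  induction k with
  | zero => rfl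
  | succ k ih =>
    exact (congrArg (fun X => ampl (E := E) X) ih).trans
      (ampl_sub (amplPow (E := E) T k) (amplPow (E := E) T' k))

lemma amplPow_adj (T : Intertwiner R S) (k : ℕ) :
    amplPow (E := E) (Intertwiner.adj T) k = Intertwiner.adj (amplPow T k) := by
  induction k with
  | zero => rfl
  | succ k ih =>
    exact (congrArg (fun X => ampl (E := E) X) ih).trans (ampl_adj (amplPow (E := E) T k))

lemma amplPow_id (k : ℕ) :
    amplPow (E := E) (Intertwiner.id R) k = Intertwiner.id (tensPow E k R) := by
  induction k with
  | zero => rfl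
  | succ k ih =>
    exact (congrArg (fun X => ampl (E := E) X) ih).trans (ampl_id (E := E) (R := tensPow E k R))

/-- `I_{E^{⊗ k}} ⊗ T` as an operator from `E^{⊗ k} ⊗ R` to `E^{⊗ (k + 1)} ⊗ S`, for an
intertwiner `T` from `R` to `E ⊗ S`. -/
noncomputable def shiftAmpl (T : Intertwiner R (tens E S)) :
    (k : ℕ) → Intertwiner (tensPow E k R) (tensPow E (k + 1) S)
  | 0 => T
  | k + 1 => ampl (R := tensPow E k R) (S := tensPow E (k + 1) S) (shiftAmpl T k)

lemma amplPow_comp_shiftPow {T : Intertwiner R S} {η : Intertwiner R (tens E R)}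
    {ζ : Intertwiner S (tens E S)}
    (h : Intertwiner.comp (ampl T) η = Intertwiner.comp ζ T) (k : ℕ) :
    Intertwiner.comp (amplPow (E := E) T (k + 1)) (shiftPow η k)
      = Intertwiner.comp (shiftPow ζ k) (amplPow T k) := by
  induction k with
  | zero => exact h
  | succ k ih =>
    refine (ampl_comp (E := E) (amplPow (E := E) T (k + 1)) (shiftPow η k)).symm.trans ?_
    exact (congrArg (fun X => ampl (E := E) X) ih).trans
      (ampl_comp (E := E) (shiftPow ζ k) (amplPow T k))

lemma amplPow_comp_genPow {T : Intertwiner R S} {η : Intertwiner R (tens E R)}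
    {ζ : Intertwiner S (tens E S)}
    (h : Intertwiner.comp (ampl T) η = Intertwiner.comp ζ T) (k : ℕ) (x : R) :
    (amplPow (E := E) T k).1 ((genPow η k).1 x) = (genPow ζ k).1 (T.1 x) := by
  induction k with
  | zero => rfl
  | succ k ih =>
    change (Intertwiner.comp (amplPow (E := E) T (k + 1)) (shiftPow η k)).1 ((genPow η k).1 x)
      = (shiftPow ζ k).1 ((genPow ζ k).1 (T.1 x))
    rw [amplPow_comp_shiftPow h, ← ih]
    rfl

lemma shiftPow_genPow (η : Intertwiner R (tens E R)) (k : ℕ) (x : R) :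
    (shiftPow η k).1 ((genPow η k).1 x) = (genPow η (k + 1)).1 x := rfl

lemma tendsto_genPow {η : Intertwiner R (tens E R)} (hη : ‖η‖ < 1) (x : R) :
    Filter.Tendsto (fun k => ‖(genPow η k).1 x‖) Filter.atTop (nhds 0) := by
  refine squeeze_zero (fun _ => norm_nonneg _) (fun k => norm_genPow_apply_le η k x) ?_
  simpa using (tendsto_pow_atTop_nhds_zero_of_lt_one (norm_nonneg η) hη).mul_const ‖x‖

/-- A pairing of `η^{(k)} x` with bounded vectors through the uniformly bounded operators
`I_{E^{⊗ k}} ⊗ T` vanishes in the limit. -/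
lemma tendsto_inner_genPow {η : Intertwiner R (tens E R)} (hη : ‖η‖ < 1) (T : Intertwiner R S)
    (x : R) (w : ∀ k, tensPow E k S) {C : ℝ} (hw : ∀ k, ‖w k‖ ≤ C) :
    Filter.Tendsto (fun k => inner ℂ (w k) ((amplPow (E := E) T k).1 ((genPow η k).1 x)))
      Filter.atTop (nhds 0) := by
  refine squeeze_zero_norm (a := fun k => C * (‖T‖ * ‖(genPow η k).1 x‖)) (fun k => ?_) ?_
  · refine (norm_inner_le_norm _ _).trans ?_
    have h1 := (amplPow (E := E) T k).1.le_of_opNorm_le (norm_amplPow_le T k) ((genPow η k).1 x)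
    have h2 : 0 ≤ C := (norm_nonneg _).trans (hw k)
    gcongr
    exact hw k
  · simpa using ((tendsto_genPow hη x).const_mul ‖T‖).const_mul C

end Powers

/-! ### The displacement equation -/

section Stein

variable {M : Type v} {E : Type u} [CStarAlgebra M] [PartialOrder M] [StarOrderedRing M]
  [NormedAddCommGroup E] [NormedSpace ℂ E] [Module Mᵐᵒᵖ E] [CStarModule Mᵐᵒᵖ E]
  [Correspondence M E] {R S : HilbRep.{u} M}

lemma isClosed_intertwiner (R S : HilbRep.{u} M) :
    IsClosed (Intertwiner R S : Set (R →L[ℂ] S)) := by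
  have h : (Intertwiner R S : Set (R →L[ℂ] S))
      = ⋂ a, {T | T ∘L R.rep a = S.rep a ∘L T} := by
    ext T
    simp only [Set.mem_iInter]
    rfl
  rw [h]
  exact isClosed_iInter fun a => isClosed_eq (by fun_prop) (by fun_prop)

/-- The map `X ↦ η* (I_E ⊗ X) η` on the commutant. -/
noncomputable def stein (η : Intertwiner R (tens E R)) (X : Intertwiner R R) : Intertwiner R R :=
  Intertwiner.comp (Intertwiner.adj η) (Intertwiner.comp (ampl X) η)

lemma norm_stein_sub_le (η : Intertwiner R (tens E R)) (X Y : Intertwiner R R) :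
    ‖stein η X - stein η Y‖ ≤ ‖η‖ ^ 2 * ‖X - Y‖ := by
  have h : stein η X - stein η Y = stein η (X - Y) := by
    refine Subtype.ext (ContinuousLinearMap.ext fun x => ?_)
    change (Intertwiner.adj η).1 ((ampl X).1 (η.1 x)) - (Intertwiner.adj η).1 ((ampl Y).1 (η.1 x))
      = (Intertwiner.adj η).1 ((ampl (X - Y)).1 (η.1 x))
    rw [ampl_sub, ← map_sub]
    rfl
  rw [h]
  change ‖η.1.adjoint ∘L (ampl (E := E) (X - Y)).1 ∘L η.1‖ ≤ _
  calc ‖η.1.adjoint ∘L (ampl (E := E) (X - Y)).1 ∘L η.1‖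
      ≤ ‖η.1.adjoint‖ * (‖(ampl (E := E) (X - Y)).1‖ * ‖η.1‖) :=
        (ContinuousLinearMap.opNorm_comp_le _ _).trans
          (mul_le_mul_of_nonneg_left (ContinuousLinearMap.opNorm_comp_le _ _) (norm_nonneg _))
    _ = ‖η‖ * (‖(ampl (E := E) (X - Y)).1‖ * ‖η‖) := by
        rw [LinearIsometryEquiv.norm_map]; rfl
    _ ≤ ‖η‖ * (‖X - Y‖ * ‖η‖) := by
        gcongr
        exact norm_ampl_le (X - Y)
    _ = ‖η‖ ^ 2 * ‖X - Y‖ := by ring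

/-- The equation `A - η* (I_E ⊗ A) η = Q` is uniquely solvable in the commutant, because
`X ↦ Q + η* (I_E ⊗ X) η` is a contraction of this complete space. -/
lemma existsUnique_stein {η : Intertwiner R (tens E R)} (hη : ‖η‖ < 1) (Q : Intertwiner R R) :
    ∃! A, A - stein η A = Q := by
  have : CompleteSpace (Intertwiner R R) := (isClosed_intertwiner R R).completeSpace_coe
  have hc : ContractingWith ⟨‖η‖ ^ 2, by positivity⟩ fun X => Q + stein η X :=
    ⟨pow_lt_one₀ (norm_nonneg _) hη two_ne_zero, LipschitzWith.of_dist_le_mul fun X Y => by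
      rw [dist_add_left, dist_eq_norm, dist_eq_norm]
      exact norm_stein_sub_le η X Y⟩
  refine ⟨hc.fixedPoint, sub_eq_iff_eq_add.mpr hc.fixedPoint_isFixedPt.symm, fun A hA => ?_⟩
  exact hc.fixedPoint_unique (sub_eq_iff_eq_add.mp hA).symm

lemma amplPow_stein {η : Intertwiner R (tens E R)} {A Q : Intertwiner R R}
    (h : A - stein η A = Q) (k : ℕ) :
    amplPow (E := E) A k = amplPow Q k + Intertwiner.comp (Intertwiner.adj (shiftPow η k))
      (Intertwiner.comp (amplPow A (k + 1)) (shiftPow η k)) := by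
  induction k with
  | zero => exact sub_eq_iff_eq_add.mp h
  | succ k ih =>
    refine (congrArg (fun X => ampl (E := E) X) ih).trans ((ampl_add (E := E) _ _).trans ?_)
    refine congrArg₂ (· + ·) rfl ?_
    refine (ampl_comp (E := E) _ _).trans ?_
    exact congrArg₂ Intertwiner.comp (ampl_adj (E := E) (shiftPow η k)) (ampl_comp (E := E) _ _)

lemma inner_stein_sum {η : Intertwiner R (tens E R)} {A Q : Intertwiner R R}
    (h : A - stein η A = Q) (x y : R) (n : ℕ) :
    inner ℂ x (A.1 y)
      = ∑ k ∈ Finset.range n, inner ℂ ((genPow η k).1 x) ((amplPow Q k).1 ((genPow η k).1 y))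
        + inner ℂ ((genPow η n).1 x) ((amplPow A n).1 ((genPow η n).1 y)) := by
  induction n with
  | zero =>
    rw [Finset.sum_range_zero, zero_add]
    rfl
  | succ n ih =>
    rw [Finset.sum_range_succ, add_assoc, ih]
    congr 1
    conv_lhs => rw [amplPow_stein h n]
    change inner ℂ ((genPow η n).1 x) ((amplPow Q n).1 ((genPow η n).1 y)
      + (Intertwiner.adj (shiftPow η n)).1 ((amplPow A (n + 1)).1
        ((shiftPow η n).1 ((genPow η n).1 y)))) = _
    rw [inner_add_right, Intertwiner.adj_inner_right, shiftPow_genPow, shiftPow_genPow]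

/-- The solution of `A - η* (I_E ⊗ A) η = Q` is the sum of the series
`∑ η^{(k)}* (I_{E^{⊗ k}} ⊗ Q) η^{(k)}`. -/
lemma tendsto_stein_sum {η : Intertwiner R (tens E R)} (hη : ‖η‖ < 1) {A Q : Intertwiner R R}
    (h : A - stein η A = Q) (x y : R) :
    Filter.Tendsto (fun n => ∑ k ∈ Finset.range n,
        inner ℂ ((genPow η k).1 x) ((amplPow Q k).1 ((genPow η k).1 y)))
      Filter.atTop (nhds (inner ℂ x (A.1 y))) := by
  have hb : ∀ k, ‖(genPow η k).1 x‖ ≤ ‖x‖ := fun k =>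
    (norm_genPow_apply_le η k x).trans
      (mul_le_of_le_one_left (norm_nonneg _) (pow_le_one₀ (norm_nonneg _) hη.le))
  have h1 := (tendsto_const_nhds (x := inner ℂ x (A.1 y))).sub
    (tendsto_inner_genPow hη A y (fun k => (genPow η k).1 x) hb)
  rw [sub_zero] at h1
  refine h1.congr fun n => ?_
  rw [inner_stein_sum h x y n, add_sub_cancel_right]

lemma inner_fockAmpl_cauchy {η : Intertwiner R (tens E R)} (hη : ‖η‖ < 1)
    (T : Intertwiner R S) (x y : R) :
    HasSum (fun k => inner ℂ ((genPow η k).1 x)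
        ((amplPow (E := E) (Intertwiner.comp (Intertwiner.adj T) T) k).1 ((genPow η k).1 y)))
      (inner ℂ (fockAmpl (E := E) T (cauchy η hη x)) (fockAmpl T (cauchy η hη y))) := by
  refine (lp.hasSum_inner (𝕜 := ℂ) _ _).congr_fun fun k => ?_
  rw [amplPow_comp, amplPow_adj]
  exact Intertwiner.adj_inner_right (amplPow (E := E) T k) _ _

/-- The solution of `A - η* (I_E ⊗ A) η = T* T - T'* T'`, as a difference of Gram operators on the
Fock space. -/
lemma inner_of_stein {S' : HilbRep.{u} M} {η : Intertwiner R (tens E R)} (hη : ‖η‖ < 1)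
    {A : Intertwiner R R} (T : Intertwiner R S) (T' : Intertwiner R S')
    (h : A - stein η A = Intertwiner.comp (Intertwiner.adj T) T
      - Intertwiner.comp (Intertwiner.adj T') T') (x y : R) :
    inner ℂ x (A.1 y) = inner ℂ (fockAmpl (E := E) T (cauchy η hη x)) (fockAmpl T (cauchy η hη y))
      - inner ℂ (fockAmpl (E := E) T' (cauchy η hη x)) (fockAmpl T' (cauchy η hη y)) := by
  refine tendsto_nhds_unique (tendsto_stein_sum hη h x y) ?_
  refine ((inner_fockAmpl_cauchy hη T x y).sub
    (inner_fockAmpl_cauchy hη T' x y)).tendsto_sum_nat.congr fun n => ?_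
  refine Finset.sum_congr rfl fun k _ => ?_
  rw [amplPow_sub, ← inner_sub_right]
  rfl

end Stein

/-! ### Input-output operators of contractive systems -/

section System

variable {M : Type v} {E : Type u} [CStarAlgebra M] [PartialOrder M] [StarOrderedRing M]
  [NormedAddCommGroup E] [NormedSpace ℂ E] [Module Mᵐᵒᵖ E] [CStarModule Mᵐᵒᵖ E]
  [Correspondence M E] {K R : HilbRep.{u} M}

lemma BlockContraction.pow {a : Intertwiner K (tens E K)} {c : Intertwiner R (tens E K)}
    {b : Intertwiner K R} {d : Intertwiner R R} (h : BlockContraction a c b d) (k : ℕ) :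
    BlockContraction (shiftAmpl a k) (shiftAmpl c k) (amplPow (E := E) b k) (amplPow d k) := by
  induction k with
  | zero => exact h
  | succ k ih => exact ih.ampl (E := E)

/-- The states `x_k ∈ E^{⊗ k} ⊗ K` of the system `x_{k+1} = a_k x_k + c_k f_k` started at `x_0 = 0`
and driven by `f`, where `a_k = I_{E^{⊗ k}} ⊗ a` and `c_k = I_{E^{⊗ k}} ⊗ c`. -/
noncomputable def state (a : Intertwiner K (tens E K)) (c : Intertwiner R (tens E K))
    (f : Fock E R) : (k : ℕ) → tensPow E k K
  | 0 => (0 : K)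
  | k + 1 => (shiftAmpl a k).1 (state a c f k) + (shiftAmpl c k).1 (f k)

/-- The outputs `y_k = b_k x_k + d_k f_k ∈ E^{⊗ k} ⊗ R` of the system with states `x_k`. -/
noncomputable def output (a : Intertwiner K (tens E K)) (c : Intertwiner R (tens E K))
    (b : Intertwiner K R) (d : Intertwiner R R) (f : Fock E R) (k : ℕ) : tensPow E k R :=
  (amplPow b k).1 (state a c f k) + (amplPow d k).1 (f k)

variable (a : Intertwiner K (tens E K)) (c : Intertwiner R (tens E K))
  (b : Intertwiner K R) (d : Intertwiner R R)

lemma state_succ (f : Fock E R) (k : ℕ) :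
    state a c f (k + 1) = (shiftAmpl a k).1 (state a c f k) + (shiftAmpl c k).1 (f k) := rfl

lemma state_add (f g : Fock E R) (k : ℕ) :
    state a c (f + g) k = state a c f k + state a c g k := by
  induction k with
  | zero => exact (add_zero (0 : K)).symm
  | succ k ih =>
    simp only [state_succ, ih, lp.coeFn_add, Pi.add_apply, map_add]
    exact add_add_add_comm _ _ _ _

lemma state_smul (r : ℂ) (f : Fock E R) (k : ℕ) : state a c (r • f) k = r • state a c f k := by
  induction k with
  | zero => exact (smul_zero r : r • (0 : K) = 0).symm
  | succ k ih =>
    simp only [state_succ, ih, lp.coeFn_smul, Pi.smul_apply, map_smul]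
    exact (smul_add r _ _).symm

variable {a c b d}

/-- The energy balance: the energy of the state and the past outputs is at most that of the past
inputs. -/
lemma state_energy (h : BlockContraction a c b d) (f : Fock E R) (n : ℕ) :
    ‖state a c f n‖ ^ 2 + ∑ k ∈ Finset.range n, ‖output a c b d f k‖ ^ 2
      ≤ ∑ k ∈ Finset.range n, ‖f k‖ ^ 2 := by
  induction n with
  | zero => simp [state]
  | succ n ih =>
    rw [Finset.sum_range_succ, Finset.sum_range_succ]
    have h1 := h.pow n (state a c f n) (f n)
    rw [← state_succ] at h1
    change ‖state a c f (n + 1)‖ ^ 2 + ‖output a c b d f n‖ ^ 2 ≤ _ at h1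
    linarith

lemma sum_norm_sq_le (f : Fock E R) (s : Finset ℕ) : ∑ k ∈ s, ‖f k‖ ^ 2 ≤ ‖f‖ ^ 2 := by
  simpa using lp.sum_rpow_le_norm_rpow (p := 2) (by norm_num) f s

lemma norm_state_le (h : BlockContraction a c b d) (f : Fock E R) (n : ℕ) :
    ‖state a c f n‖ ≤ ‖f‖ := by
  rw [← sq_le_sq₀ (norm_nonneg _) (norm_nonneg _)]
  have h1 : 0 ≤ ∑ k ∈ Finset.range n, ‖output a c b d f k‖ ^ 2 := by positivity
  linarith [state_energy h f n, sum_norm_sq_le f (Finset.range n)]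

lemma sum_output_le (h : BlockContraction a c b d) (f : Fock E R) (s : Finset ℕ) :
    ∑ k ∈ s, ‖output a c b d f k‖ ^ (2 : ENNReal).toReal ≤ ‖f‖ ^ (2 : ENNReal).toReal := by
  simp only [ENNReal.toReal_ofNat, Real.rpow_ofNat]
  obtain ⟨n, hn⟩ := s.exists_nat_subset_range
  have h1 : ∑ k ∈ s, ‖output a c b d f k‖ ^ 2
      ≤ ∑ k ∈ Finset.range n, ‖output a c b d f k‖ ^ 2 :=
    Finset.sum_le_sum_of_subset_of_nonneg hn fun _ _ _ => sq_nonneg _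
  have h2 : 0 ≤ ‖state a c f n‖ ^ 2 := sq_nonneg _
  linarith [state_energy h f n, sum_norm_sq_le f (Finset.range n)]

/-- The input-output operator of a contractive system, a contraction on the Fock space. -/
noncomputable def ioMap (h : BlockContraction a c b d) : Fock E R →L[ℂ] Fock E R :=
  LinearMap.mkContinuous
    { toFun := fun f => ⟨output a c b d f, memℓp_gen' (sum_output_le h f)⟩
      map_add' := fun f g => by
        ext k
        change output a c b d (f + g) k = output a c b d f k + output a c b d g k
        simp only [output, state_add, lp.coeFn_add, Pi.add_apply, map_add]
        exact add_add_add_comm _ _ _ _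
      map_smul' := fun r f => by
        ext k
        change output a c b d (r • f) k = r • output a c b d f k
        simp only [output, state_smul, lp.coeFn_smul, Pi.smul_apply, map_smul]
        exact (smul_add r _ _).symm }
    1 fun f => by
      rw [one_mul]
      exact lp.norm_le_of_forall_sum_le (by norm_num) (norm_nonneg _) (sum_output_le h f)

lemma norm_ioMap_le (h : BlockContraction a c b d) : ‖ioMap h‖ ≤ 1 :=
  LinearMap.mkContinuous_norm_le _ zero_le_one _

/-- The input supported in the `i`-th summand of the Fock space. -/
noncomputable def impulse (i : ℕ) (x : tensPow E i R) : Fock E R :=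
  lp.singleContinuousLinearMap ℂ (fun k : ℕ => (tensPow E k R : Type u)) 2 i x

lemma impulse_self (i : ℕ) (x : tensPow E i R) : (impulse i x : Fock E R) i = x :=
  lp.single_apply_self (E := fun k : ℕ => (tensPow E k R : Type u)) 2 i x

lemma impulse_ne {i k : ℕ} (hk : k ≠ i) (x : tensPow E i R) : (impulse i x : Fock E R) k = 0 :=
  lp.single_apply_ne (E := fun k : ℕ => (tensPow E k R : Type u)) 2 i x hk

/-- The value at time `k` of an impulse at time `i` is given by an intertwiner, which amplifies by
`I_E` when both times are shifted by one. -/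
lemma exists_impulse (i k : ℕ) :
    ∃ P : Intertwiner (tensPow E i R) (tensPow E k R),
      (∀ x, (impulse i x : Fock E R) k = P.1 x) ∧
      ∀ y, (impulse (i + 1) y : Fock E R) (k + 1) = (ampl (E := E) P).1 y := by
  by_cases hik : k = i
  · subst hik
    refine ⟨Intertwiner.id _, fun x => impulse_self k x, fun y => ?_⟩
    rw [ampl_id]
    exact impulse_self (k + 1) y
  · refine ⟨0, fun x => impulse_ne hik x, fun y => ?_⟩
    rw [ampl_zero]
    exact impulse_ne (by omega) y

lemma exists_impulse_state (a : Intertwiner K (tens E K)) (c : Intertwiner R (tens E K))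
    (i k : ℕ) :
    ∃ P : Intertwiner (tensPow E i R) (tensPow E k K),
      (∀ x, state a c (impulse i x) k = P.1 x) ∧
      ∀ y, state a c (impulse (i + 1) y) (k + 1) = (ampl (E := E) P).1 y := by
  induction k with
  | zero =>
    refine ⟨0, fun x => rfl, fun y => ?_⟩
    rw [ampl_zero, state_succ, impulse_ne (by omega)]
    change (shiftAmpl a 0).1 0 + (shiftAmpl c 0).1 0 = 0
    rw [map_zero, map_zero, add_zero]
  | succ k ih =>
    obtain ⟨P, hP, hP'⟩ := ih
    obtain ⟨D, hD, hD'⟩ := exists_impulse (E := E) (R := R) i k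
    refine ⟨Intertwiner.comp (shiftAmpl a k) P + Intertwiner.comp (shiftAmpl c k) D,
      fun x => ?_, fun y => ?_⟩
    · rw [state_succ, hP, hD]
      rfl
    · rw [state_succ, hP', hD', ampl_add, ampl_comp, ampl_comp]
      rfl

/-- The impulse responses are intertwiners, and they form a Toeplitz matrix: shifting both times by
one amplifies the response by `I_E`. -/
lemma exists_impulse_output (a : Intertwiner K (tens E K)) (c : Intertwiner R (tens E K))
    (b : Intertwiner K R) (d : Intertwiner R R) (i k : ℕ) :
    ∃ P : Intertwiner (tensPow E i R) (tensPow E k R),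
      (∀ x, output a c b d (impulse i x) k = P.1 x) ∧
      ∀ y, output a c b d (impulse (i + 1) y) (k + 1) = (ampl (E := E) P).1 y := by
  obtain ⟨P, hP, hP'⟩ := exists_impulse_state a c i k
  obtain ⟨D, hD, hD'⟩ := exists_impulse (E := E) (R := R) i k
  refine ⟨Intertwiner.comp (amplPow b k) P + Intertwiner.comp (amplPow d k) D,
    fun x => ?_, fun y => ?_⟩
  · rw [output, hP, hD]
    rfl
  · rw [output, hP', hD', ampl_add, ampl_comp, ampl_comp]
    rfl

lemma state_impulse_eq_zero (i : ℕ) (x : tensPow E i R) {k : ℕ} (hk : k ≤ i) :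
    state a c (impulse i x) k = 0 := by
  induction k with
  | zero => rfl
  | succ k ih =>
    rw [state_succ, ih (by omega), impulse_ne (by omega), map_zero, map_zero, add_zero]

lemma entry_apply (T : Fock E R →L[ℂ] Fock E R) (i j : ℕ) (x : tensPow E j R) :
    entry T i j x = (T (impulse j x) : Fock E R) i := rfl

lemma inner_impulse_left (i : ℕ) (x : tensPow E i R) (f : Fock E R) :
    inner ℂ (impulse i x) f = inner ℂ x (f i) :=
  lp.inner_single_left i x f

lemma entry_adjoint (T : Fock E R →L[ℂ] Fock E R) (i j : ℕ) :
    entry T.adjoint i j = (entry T j i).adjoint := by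
  refine ContinuousLinearMap.ext fun x => ext_inner_left ℂ fun y => ?_
  rw [ContinuousLinearMap.adjoint_inner_right, entry_apply, entry_apply, ← inner_impulse_left,
    ContinuousLinearMap.adjoint_inner_right, ← inner_conj_symm, inner_impulse_left,
    inner_conj_symm]

/-- The adjoint of the input-output operator of a contractive system is of Schur class. -/
lemma isSchur_adjoint_ioMap (h : BlockContraction a c b d) : IsSchur E R (ioMap h).adjoint := by
  -- an entry of the adjoint is the adjoint of an impulse response
  have hentry : ∀ i j (P : Intertwiner (tensPow E i R) (tensPow E j R)),
      (∀ x, output a c b d (impulse i x) j = P.1 x) →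
        entry (ioMap h).adjoint i j = (Intertwiner.adj P).1 := by
    intro i j P hP
    rw [entry_adjoint]
    exact congrArg ContinuousLinearMap.adjoint (ContinuousLinearMap.ext hP)
  refine ⟨?_, fun i j hij => ?_, fun j => ?_, fun i j _ => ?_⟩
  · rw [LinearIsometryEquiv.norm_map]
    exact norm_ioMap_le h
  · rw [hentry i j 0 fun x => ?_]
    · exact map_zero ContinuousLinearMap.adjoint
    · rw [output, state_impulse_eq_zero i x hij.le, impulse_ne hij.ne, map_zero, map_zero,
        add_zero]
      rfl
  · obtain ⟨P, hP, -⟩ := exists_impulse_output a c b d 0 j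
    rw [hentry 0 j P hP]
    exact (Intertwiner.adj P).2
  · obtain ⟨P, hP, hP'⟩ := exists_impulse_output a c b d i j
    have h1 := hentry i j P hP
    refine ⟨by rw [h1]; exact (Intertwiner.adj P).2, ?_⟩
    rw [hentry (i + 1) (j + 1) (ampl (E := E) P) hP', ← ampl_adj]
    congr 2
    exact Subtype.ext h1.symm

/-! ### Interpolation by the input-output operator -/

lemma ampl_adj_comp_add {K X Y Z : HilbRep.{u} M} {r : Intertwiner K X} {p : Intertwiner X Y}
    {s : Intertwiner K Y} {q : Intertwiner X Z} {t : Intertwiner K Z}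
    (h : r = Intertwiner.comp (Intertwiner.adj p) s + Intertwiner.comp (Intertwiner.adj q) t) :
    ampl (E := E) r = Intertwiner.comp (Intertwiner.adj (ampl p)) (ampl s)
      + Intertwiner.comp (Intertwiner.adj (ampl q)) (ampl t) := by
  rw [h, ampl_add, ampl_comp, ampl_comp, ampl_adj, ampl_adj]

/-- A relation `r = p* s + q* t` between intertwiners, amplified by `I_{E^{⊗ k}}`, where `p` and
`s = (I_E ⊗ B) ζ` take values in a space of the form `E ⊗ ·`. -/
lemma pow_adj_comp_add {X : HilbRep.{u} M} {r : Intertwiner K X} {p : Intertwiner X (tens E K)}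
    {B : Intertwiner K K} {ζ : Intertwiner K (tens E K)} {q : Intertwiner X R}
    {t : Intertwiner K R}
    (h : r = Intertwiner.comp (Intertwiner.adj p) (Intertwiner.comp (ampl B) ζ)
      + Intertwiner.comp (Intertwiner.adj q) t) (k : ℕ) :
    amplPow (E := E) r k = Intertwiner.comp (Intertwiner.adj (shiftAmpl p k))
        (Intertwiner.comp (amplPow B (k + 1)) (shiftPow ζ k))
      + Intertwiner.comp (Intertwiner.adj (amplPow q k)) (amplPow t k) := by
  induction k with
  | zero => exact h
  | succ k ih =>
    refine (ampl_adj_comp_add (E := E) ih).trans ?_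
    refine congrArg₂ (· + ·) (congrArg₂ Intertwiner.comp rfl ?_) rfl
    exact ampl_comp (E := E) _ _

lemma inner_pow_adj_comp_add {X : HilbRep.{u} M} {r : Intertwiner K X}
    {p : Intertwiner X (tens E K)} {B : Intertwiner K K} {ζ : Intertwiner K (tens E K)}
    {q : Intertwiner X R} {t : Intertwiner K R}
    (h : r = Intertwiner.comp (Intertwiner.adj p) (Intertwiner.comp (ampl B) ζ)
      + Intertwiner.comp (Intertwiner.adj q) t) (k : ℕ) (w : tensPow E k X) (x : K) :
    inner ℂ w ((amplPow (E := E) r k).1 ((genPow ζ k).1 x))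
      = inner ℂ ((shiftAmpl p k).1 w) ((amplPow B (k + 1)).1 ((genPow ζ (k + 1)).1 x))
        + inner ℂ ((amplPow q k).1 w) ((amplPow t k).1 ((genPow ζ k).1 x)) := by
  rw [pow_adj_comp_add h k]
  change inner ℂ w ((Intertwiner.adj (shiftAmpl p k)).1 ((amplPow B (k + 1)).1
      ((shiftPow ζ k).1 ((genPow ζ k).1 x)))
    + (Intertwiner.adj (amplPow q k)).1 ((amplPow t k).1 ((genPow ζ k).1 x))) = _
  rw [inner_add_right, Intertwiner.adj_inner_right, Intertwiner.adj_inner_right, shiftPow_genPow]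

/-- If the adjoint of the system matrix `[a c; b d]` maps the column `[(I_E ⊗ B) ζ; t]` to
`[B; r]`, then the adjoint of its input-output operator maps `(I ⊗ t) C(ζ)` to `(I ⊗ r) C(ζ)`. The
pairings of `x_k` with `(I_{E^{⊗ k}} ⊗ B) ζ^{(k)} x` telescope, and they vanish in the limit. -/
lemma inner_ioMap_cauchy (h : BlockContraction a c b d) {B : Intertwiner K K}
    {ζ : Intertwiner K (tens E K)} (hζ : ‖ζ‖ < 1) {t r : Intertwiner K R}
    (hB : B = Intertwiner.comp (Intertwiner.adj a) (Intertwiner.comp (ampl B) ζ)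
      + Intertwiner.comp (Intertwiner.adj b) t)
    (hr : r = Intertwiner.comp (Intertwiner.adj c) (Intertwiner.comp (ampl B) ζ)
      + Intertwiner.comp (Intertwiner.adj d) t) (f : Fock E R) (x : K) :
    inner ℂ (ioMap h f) (fockAmpl (E := E) t (cauchy ζ hζ x))
      = inner ℂ f (fockAmpl (E := E) r (cauchy ζ hζ x)) := by
  have hstep : ∀ n, ∑ k ∈ Finset.range n,
        inner ℂ (f k) ((amplPow (E := E) r k).1 ((genPow ζ k).1 x))
      - inner ℂ (state a c f n) ((amplPow (E := E) B n).1 ((genPow ζ n).1 x))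
      = ∑ k ∈ Finset.range n,
        inner ℂ (output a c b d f k) ((amplPow (E := E) t k).1 ((genPow ζ k).1 x)) := by
    intro n
    induction n with
    | zero =>
      rw [Finset.sum_range_zero, Finset.sum_range_zero, zero_sub, neg_eq_zero]
      exact inner_zero_left _
    | succ n ih =>
      rw [Finset.sum_range_succ, Finset.sum_range_succ, ← ih,
        inner_pow_adj_comp_add hr n (f n), inner_pow_adj_comp_add hB n (state a c f n), state_succ,
        output, inner_add_left, inner_add_left]
      ring
  have h1 := (lp.hasSum_inner (𝕜 := ℂ) (ioMap h f)
    (fockAmpl (E := E) t (cauchy ζ hζ x))).tendsto_sum_nat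
  have h2 := (lp.hasSum_inner (𝕜 := ℂ) f (fockAmpl (E := E) r (cauchy ζ hζ x))).tendsto_sum_nat
  have h3 := h2.sub (tendsto_inner_genPow hζ B x (state a c f) (norm_state_le h f))
  rw [sub_zero] at h3
  exact tendsto_nhds_unique h1 (h3.congr hstep)

end System

/-! ### The Pick matrix -/

section Pick

variable {M : Type v} {E : Type u} [CStarAlgebra M] [PartialOrder M] [StarOrderedRing M]
  [NormedAddCommGroup E] [NormedSpace ℂ E] [Module Mᵐᵒᵖ E] [CStarModule Mᵐᵒᵖ E]
  [Correspondence M E] {R : HilbRep.{u} M} {N : ℕ}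

lemma Intertwiner.sum_apply {S : HilbRep.{u} M} {ι : Type*} (s : Finset ι)
    (T : ι → Intertwiner R S) (x : R) : (∑ i ∈ s, T i).1 x = ∑ i ∈ s, (T i).1 x := by
  rw [AddSubmonoidClass.coe_finsetSum, _root_.sum_apply]

lemma incl_inner_incl (i j : Fin N) (x y : R) :
    inner ℂ ((incl i : Intertwiner R (copies N R)).1 x) ((incl j).1 y)
      = if i = j then inner ℂ x y else 0 := by
  rw [incl, Intertwiner.adj_inner_left]
  rw [incl_apply]
  split_ifs <;> simp

lemma zDiag_comp_incl (z : Fin N → Intertwiner R (tens E R)) (j : Fin N) :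
    Intertwiner.comp (ampl (incl j)) (z j) = Intertwiner.comp (zDiag z) (incl j) := by
  refine Subtype.ext (ContinuousLinearMap.ext fun x => ?_)
  change (ampl (incl j)).1 ((z j).1 x) = (zDiag z).1 ((incl j).1 x)
  rw [zDiag, Intertwiner.sum_apply, Finset.sum_eq_single j]
  · change _ = (ampl (incl j)).1 ((z j).1 ((coord j).1 ((incl j).1 x)))
    rw [incl_apply, if_pos rfl]
  · intro i _ hij
    change (ampl (incl i)).1 ((z i).1 ((coord i).1 ((incl j).1 x))) = 0
    rw [incl_apply, if_neg hij, map_zero, map_zero]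
  · simp

lemma adj_colU_comp_incl (j : Fin N) :
    Intertwiner.comp (Intertwiner.adj (colU N R)) (incl j) = Intertwiner.id R := by
  refine Subtype.ext (ContinuousLinearMap.ext fun x => ext_inner_left ℂ fun w => ?_)
  change inner ℂ w ((Intertwiner.adj (colU N R)).1 ((incl j).1 x)) = inner ℂ w x
  rw [Intertwiner.adj_inner_right, colU, Intertwiner.sum_apply, sum_inner]
  simp [incl_inner_incl]

lemma adj_colV_comp_incl (Λ : Fin N → Intertwiner R R) (j : Fin N) :
    Intertwiner.comp (Intertwiner.adj (colV Λ)) (incl j) = Λ j := by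
  refine Subtype.ext (ContinuousLinearMap.ext fun x => ext_inner_left ℂ fun w => ?_)
  change inner ℂ w ((Intertwiner.adj (colV Λ)).1 ((incl j).1 x)) = inner ℂ w ((Λ j).1 x)
  rw [Intertwiner.adj_inner_right, colV, Intertwiner.sum_apply, sum_inner]
  change ∑ i, inner ℂ ((incl i).1 ((Intertwiner.adj (Λ i)).1 w)) ((incl j).1 x) = _
  simp [incl_inner_incl, Intertwiner.adj_inner_left]

/-- Restricted to the `j`-th summand of `R^{(N)}`, the Cauchy kernel of `diag(z_1, …, z_N)` is that
of `z_j`. -/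
lemma fockAmpl_cauchy_incl (z : Fin N → Intertwiner R (tens E R)) (hz : ∀ j, ‖z j‖ < 1)
    (T : Intertwiner (copies N R) R) (j : Fin N) (x : R) :
    fockAmpl (E := E) T (cauchy (zDiag z) (norm_zDiag_lt_one z hz) ((incl j).1 x))
      = fockAmpl (Intertwiner.comp T (incl j)) (cauchy (z j) (hz j) x) := by
  refine lp.ext (funext fun k => ?_)
  rw [fockAmpl_apply, fockAmpl_apply, cauchy_apply, cauchy_apply,
    ← amplPow_comp_genPow (zDiag_comp_incl z j), amplPow_comp]
  rfl

lemma fockAmpl_id (f : Fock E R) : fockAmpl (Intertwiner.id R) f = f := by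
  refine lp.ext (funext fun k => ?_)
  rw [fockAmpl_apply, amplPow_id]
  rfl

lemma Uinf_incl (z : Fin N → Intertwiner R (tens E R)) (hz : ∀ j, ‖z j‖ < 1) (j : Fin N) (x : R) :
    Uinf z hz ((incl j).1 x) = cauchy (z j) (hz j) x := by
  refine (fockAmpl_cauchy_incl z hz _ j x).trans ?_
  rw [adj_colU_comp_incl, fockAmpl_id]

lemma Vinf_incl (z : Fin N → Intertwiner R (tens E R)) (hz : ∀ j, ‖z j‖ < 1)
    (Λ : Fin N → Intertwiner R R) (j : Fin N) (x : R) :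
    Vinf z hz Λ ((incl j).1 x) = fockAmpl (Λ j) (cauchy (z j) (hz j) x) := by
  refine (fockAmpl_cauchy_incl z hz _ j x).trans ?_
  rw [adj_colV_comp_incl]

lemma isDisplacementSolution_iff {z : Fin N → Intertwiner R (tens E R)}
    {Λ : Fin N → Intertwiner R R} {A : Intertwiner (copies N R) (copies N R)} :
    IsDisplacementSolution z Λ A ↔ A - stein (zDiag z) A
      = Intertwiner.comp (Intertwiner.adj (Intertwiner.adj (colU N R)))
          (Intertwiner.adj (colU N R))
        - Intertwiner.comp (Intertwiner.adj (Intertwiner.adj (colV Λ)))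
          (Intertwiner.adj (colV Λ)) := by
  rw [Intertwiner.adj_adj, Intertwiner.adj_adj, Subtype.ext_iff]
  rfl

lemma IsDisplacementSolution.inner_eq {z : Fin N → Intertwiner R (tens E R)}
    {Λ : Fin N → Intertwiner R R} {A : Intertwiner (copies N R) (copies N R)}
    (hA : IsDisplacementSolution z Λ A) (hz : ∀ j, ‖z j‖ < 1) (x y : copies N R) :
    inner ℂ x (A.1 y) = inner ℂ (Uinf z hz x) (Uinf z hz y)
      - inner ℂ (Vinf z hz Λ x) (Vinf z hz Λ y) :=
  inner_of_stein _ _ _ (isDisplacementSolution_iff.mp hA) x y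

lemma IsDisplacementSolution.blocks_eq {z : Fin N → Intertwiner R (tens E R)}
    {Λ : Fin N → Intertwiner R R} {A : Intertwiner (copies N R) (copies N R)}
    (hA : IsDisplacementSolution z Λ A) (hz : ∀ j, ‖z j‖ < 1) :
    blocks A.1 = pickMatrix z hz Λ := by
  ext1 i j
  refine ContinuousLinearMap.ext fun y => ext_inner_left ℂ fun x => ?_
  have h := hA.inner_eq hz ((incl i).1 x) ((incl j).1 y)
  rw [Uinf_incl, Uinf_incl, Vinf_incl, Vinf_incl, incl, Intertwiner.adj_inner_left] at h
  refine h.trans ?_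
  change _ = inner ℂ x ((cauchy (z i) (hz i)).adjoint (cauchy (z j) (hz j) y)
    - (fockAmpl (E := E) (Λ i) ∘L cauchy (z i) (hz i)).adjoint
      (fockAmpl (E := E) (Λ j) (cauchy (z j) (hz j) y)))
  rw [inner_sub_right, ContinuousLinearMap.adjoint_inner_right,
    ContinuousLinearMap.adjoint_inner_right]
  rfl

lemma IsDisplacementSolution.isPositive {z : Fin N → Intertwiner R (tens E R)}
    {Λ : Fin N → Intertwiner R R} {A : Intertwiner (copies N R) (copies N R)}
    (hA : IsDisplacementSolution z Λ A) (hz : ∀ j, ‖z j‖ < 1) {T : Fock E R →L[ℂ] Fock E R}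
    (hT : ‖T‖ ≤ 1) (hTU : T ∘L Uinf z hz = Vinf z hz Λ) : A.1.IsPositive := by
  rw [ContinuousLinearMap.isPositive_iff_complex]
  intro x
  have h1 : inner ℂ (A.1 x) x = ((‖Uinf z hz x‖ ^ 2 - ‖Vinf z hz Λ x‖ ^ 2 : ℝ) : ℂ) := by
    rw [← inner_conj_symm, hA.inner_eq hz, inner_self_eq_norm_sq_to_K, inner_self_eq_norm_sq_to_K]
    simp
  have h2 : ‖Vinf z hz Λ x‖ ≤ ‖Uinf z hz x‖ := by
    rw [← hTU]
    simpa using T.le_of_opNorm_le hT (Uinf z hz x)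
  rw [h1]
  have h3 : ‖Vinf z hz Λ x‖ ^ 2 ≤ ‖Uinf z hz x‖ ^ 2 := by gcongr
  exact ⟨congrArg _ (Complex.ofReal_re _), (sub_nonneg.mpr h3).trans_eq (Complex.ofReal_re _).symm⟩

/-- If the solution is `A = B* B`, the displacement equation says that the columns
`[(I_E ⊗ B) z; U*]` and `[B; V*]` have the same Gram operator. The lurking isometry between them is
the adjoint of a system matrix, and the adjoint of its input-output operator interpolates. -/
lemma IsDisplacementSolution.exists_schur {z : Fin N → Intertwiner R (tens E R)}
    {Λ : Fin N → Intertwiner R R} {A : Intertwiner (copies N R) (copies N R)}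
    (hA : IsDisplacementSolution z Λ A) (hz : ∀ j, ‖z j‖ < 1) (hpos : A.1.IsPositive) :
    ∃ T ∈ schurClass (E := E) (R := R), T ∘L Uinf z hz = Vinf z hz Λ := by
  obtain ⟨B, rfl⟩ := exists_sqrt_intertwiner A hpos
  have hnorm : ∀ x : copies N R, ‖B.1 x‖ ^ 2 + ‖(Intertwiner.adj (colV Λ)).1 x‖ ^ 2
      = ‖(Intertwiner.comp (ampl B) (zDiag z)).1 x‖ ^ 2
        + ‖(Intertwiner.adj (colU N R)).1 x‖ ^ 2 := by
    intro x
    have h1 := congrArg (fun X : Intertwiner (copies N R) (copies N R) =>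
      RCLike.re (inner ℂ x (X.1 x))) (isDisplacementSolution_iff.mp hA)
    change RCLike.re (inner ℂ x ((Intertwiner.adj B).1 (B.1 x) - (Intertwiner.adj (zDiag z)).1
        ((ampl (Intertwiner.comp (Intertwiner.adj B) B)).1 ((zDiag z).1 x))))
      = RCLike.re (inner ℂ x
        ((Intertwiner.adj (Intertwiner.adj (colU N R))).1 ((Intertwiner.adj (colU N R)).1 x)
          - (Intertwiner.adj (Intertwiner.adj (colV Λ))).1
            ((Intertwiner.adj (colV Λ)).1 x))) at h1
    rw [inner_sub_right, inner_sub_right, Intertwiner.adj_inner_right,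
      Intertwiner.adj_inner_right, Intertwiner.adj_inner_right (Intertwiner.adj (colU N R)),
      Intertwiner.adj_inner_right (Intertwiner.adj (colV Λ)), ← inner_ampl, map_sub, map_sub,
      inner_self_eq_norm_sq, inner_self_eq_norm_sq, inner_self_eq_norm_sq, inner_self_eq_norm_sq] at h1
    change ‖B.1 x‖ ^ 2 + _ = ‖(ampl B).1 ((zDiag z).1 x)‖ ^ 2 + _
    linarith
  obtain ⟨a, c, b, d, hblock, hB, hV⟩ := exists_blockContraction
    (Intertwiner.comp (ampl B) (zDiag z)) (Intertwiner.adj (colU N R)) B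
    (Intertwiner.adj (colV Λ)) hnorm
  refine ⟨(ioMap hblock).adjoint, isSchur_adjoint_ioMap hblock,
    ContinuousLinearMap.ext fun x => ext_inner_left ℂ fun f => ?_⟩
  change inner ℂ f ((ioMap hblock).adjoint (Uinf z hz x)) = _
  rw [ContinuousLinearMap.adjoint_inner_right]
  exact inner_ioMap_cauchy hblock (norm_zDiag_lt_one z hz) hB hV f x

end Pick

end WCorr

theorem mainTheorem3 {M : Type v} {E H : Type u}
    [CStarAlgebra M] [PartialOrder M] [StarOrderedRing M] [WStarAlgebra M]
    [NormedAddCommGroup E] [NormedSpace ℂ E] [CompleteSpace E] [Module Mᵐᵒᵖ E]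
    [CStarModule Mᵐᵒᵖ E] [WCorr.Correspondence M E] [WCorr.IsWStarCorrespondence M E]
    [NormedAddCommGroup H] [InnerProductSpace ℂ H] [CompleteSpace H]
    (σ : M →⋆ₐ[ℂ] (H →L[ℂ] H)) (hσ_faithful : Function.Injective σ)
    (hσ_normal : ScottContinuous σ) (N : ℕ)
    (z : Fin N → WCorr.SigmaDual E σ) (hz : ∀ i, ‖z i‖ < 1)
    (Λ : Fin N → WCorr.Commutant σ) :
    (∃! A : WCorr.Intertwiner (WCorr.copies N (WCorr.ofRep σ)) (WCorr.copies N (WCorr.ofRep σ)),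
      WCorr.IsDisplacementSolution z Λ A) ∧
    ∀ A : WCorr.Intertwiner (WCorr.copies N (WCorr.ofRep σ)) (WCorr.copies N (WCorr.ofRep σ)),
      WCorr.IsDisplacementSolution z Λ A →
        WCorr.blocks A.1 = WCorr.pickMatrix z hz Λ ∧
        (A.1.IsPositive ↔
          ∃ T ∈ WCorr.schurClass (E := E) (R := WCorr.ofRep σ),
            T ∘L WCorr.Uinf z hz = WCorr.Vinf z hz Λ) := by
  refine ⟨?_, fun A hA => ⟨hA.blocks_eq hz, hA.exists_schur hz, ?_⟩⟩
  · simp only [WCorr.isDisplacementSolution_iff]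
    exact WCorr.existsUnique_stein (WCorr.norm_zDiag_lt_one z hz) _
  · rintro ⟨T, hT, hTU⟩
    exact hA.isPositive hz hT.contractive hTU
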